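/- **Theorem.** Let $m\ge 1$ be an integer, let $\omega\colon[0,\infty]\to[0,\infty]$ be a modulus of continuity, that is, a continuous, (weakly) increasing, concave function with $\omega(0)=0$ that is not identically $0$, and let $K\subset\mathbb{R}$ be compact. Let $F=(F^k)_{k=0}^m$, $G=(G^k)_{k=0}^m$, $H=(H^k)_{k=0}^m$ be collections of continuous real-valued functions on $K$. *Definitions.* A map $\varphi$ on $\mathbb{R}$ with values in $\mathbb{R}^3$ is of class $C^{m,\omega}$ if it is $C^m$ and $\sup_{a\ne b}|D^m\varphi(b)-D^m\varphi(a)|/\omega(|b-a|)<\infty$. The first Heisenberg group $\mathbb{H}^1$ is $\mathbb{R}^3$ with coordinates $(x,y,t)$ and horizontal vector fields $X=\partial_x+2y\,\partial_t$, $Y=\partial_y-2x\,\partial_t$; a curve $\Gamma\colon\mathbb{R}\to\mathbb{R}^3$ is horizontal if it is absolutely continuous on compact intervals and, for almost every $s$, $\Gamma'(s)$ is a linear combination of $X(\Gamma(s))$ and $Y(\Gamma(s))$. For $a\in K$ put $T_a^mF(x)=\sum_{k=0}^m\frac{F^k(a)}{k!}(x-a)^k$, and $T_a^{m-k}F^k(x)=\sum_{l=0}^{m-k}\frac{F^{k+l}(a)}{l!}(x-a)^l$.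 The collection $F$ is a Whitney field of class $C^{m,\omega}$ on $K$ if there is a constant $C>0$ with $|F^k(b)-T_a^{m-k}F^k(b)|\le C\,\omega(|b-a|)\,|b-a|^{m-k}$ for all $0\le k\le m$ and $a,b\in K$ (and likewise for $G$, $H$). For $a,b\in K$ with $a<b$, writing $F=F^0$, $G=G^0$, $H=H^0$ for the functions where they are evaluated at points, put $$A(a,b)=H(b)-H(a)-2\int_a^b\big((T_a^mF)'\,T_a^mG-(T_a^mG)'\,T_a^mF\big)+2F(a)\big(G(b)-T_a^mG(b)\big)-2G(a)\big(F(b)-T_a^mF(b)\big),$$ $$V_\omega(a,b)=\omega(b-a)^2(b-a)^{2m}+\omega(b-a)(b-a)^m\int_a^b\big(|(T_a^mF)'|+|(T_a^mG)'|\big).$$ *Claim.* There is a horizontal curve $\Gamma\in C^{m,\omega}(\mathbb{R},\mathbb{R}^3)$ with $D^k\Gamma|_K=(F^k,G^k,H^k)$ for all $0\le k\le m$ if and only if the following three conditions hold: 1. $F$, $G$ and $H$ are Whitney fields of class $C^{m,\omega}$ on $K$; 2. for every $1\le k\le m$, on $K$, $\displaystyle H^k=2\sum_{i=0}^{k-1}\binom{k-1}{i}\left(F^{k-i}G^i-G^{k-i}F^i\right)$;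 3. there is a constant $C\ge 1$ such that $|A(a,b)|\le C\,V_\omega(a,b)$ for all $a,b\in K$ with $a<b$. -/

import Mathlib

open MeasureTheory
open scoped ENNReal Polynomial Nat

noncomputable section

namespace HeisWhitney

/-- A modulus of continuity is a function from `[0, ∞]` to `[0, ∞]` that is continuous,
(weakly) increasing and concave, vanishes at `0` and is not identically `0`. -/
structure IsModulus (ω : ℝ≥0∞ → ℝ≥0∞) : Prop where
  continuous : Continuous ω
  monotone : Monotone ω
  concave : ConcaveOn NNReal Set.univ ω
  map_zero : ω 0 = 0
  ne_zero : ∃ t, ω t ≠ 0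

/-- The value of `ω` at a real number `t ≥ 0`, as a real number. For a modulus of continuity
nothing is lost: `ω` is finite at finite arguments, see `IsModulus.ne_top`. -/
def modVal (ω : ℝ≥0∞ → ℝ≥0∞) (t : ℝ) : ℝ := (ω (ENNReal.ofReal t)).toReal

/-- A modulus of continuity is finite on `[0, ∞)`. -/
theorem IsModulus.ne_top {ω : ℝ≥0∞ → ℝ≥0∞} (hω : IsModulus ω) {t : ℝ≥0∞} (ht : t ≠ ∞) :
    ω t ≠ ∞ := by
  intro h
  have key : ∀ n : ℕ, ω (((1 / ((n : NNReal) + 1) : NNReal)) • t) = ∞ := by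
    intro n
    have hn : (1 / ((n : NNReal) + 1) : NNReal) ≤ 1 := by
      rw [div_le_one (by positivity)]
      simp
    have hc := hω.concave.2 (Set.mem_univ t) (Set.mem_univ (0 : ℝ≥0∞))
      (zero_le : 0 ≤ (1 / ((n : NNReal) + 1) : NNReal))
      (zero_le : 0 ≤ 1 - (1 / ((n : NNReal) + 1) : NNReal)) (add_tsub_cancel_of_le hn)
    simp only [h, hω.map_zero, smul_zero, add_zero] at hc
    have htop : (1 / ((n : NNReal) + 1) : NNReal) • (∞ : ℝ≥0∞) = ∞ := by
      rw [ENNReal.smul_def, smul_eq_mul]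
      apply ENNReal.mul_top
      have : (1 / ((n : NNReal) + 1) : NNReal) ≠ 0 := by positivity
      exact_mod_cast this
    rw [htop] at hc
    exact top_le_iff.mp hc
  have hlim : Filter.Tendsto (fun n : ℕ => ((1 / ((n : NNReal) + 1) : NNReal)) • t)
      Filter.atTop (nhds 0) := by
    lift t to NNReal using ht
    have h1 : Filter.Tendsto (fun n : ℕ => ((1 / ((n : NNReal) + 1) : NNReal)) * t)
        Filter.atTop (nhds (0 * t)) :=
      (tendsto_one_div_add_atTop_nhds_zero_nat (𝕜 := NNReal)).mul_const t
    rw [zero_mul] at h1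
    have h2 := ENNReal.tendsto_coe.mpr h1
    simpa [ENNReal.smul_def] using h2
  have h3 := (hω.continuous.tendsto 0).comp hlim
  rw [hω.map_zero] at h3
  have h4 : (ω ∘ fun n : ℕ => ((1 / ((n : NNReal) + 1) : NNReal)) • t) = fun _ => ∞ := by
    funext n
    exact key n
  rw [h4] at h3
  exact ENNReal.top_ne_zero (tendsto_nhds_unique tendsto_const_nhds h3)

/-- A modulus of continuity is positive on `(0, ∞)`. -/
theorem IsModulus.modVal_pos {ω : ℝ≥0∞ → ℝ≥0∞} (hω : IsModulus ω) {t : ℝ} (ht : 0 < t) :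
    0 < modVal ω t := by
  refine ENNReal.toReal_pos ?_ (hω.ne_top ENNReal.ofReal_ne_top)
  intro h
  obtain ⟨s, hs⟩ := hω.ne_zero
  have key : ∀ n : ℕ, ω (((n : ℝ≥0∞) + 1) * ENNReal.ofReal t) = 0 := by
    intro n
    have hn : (1 / ((n : NNReal) + 1) : NNReal) ≤ 1 := by
      rw [div_le_one (by positivity)]
      simp
    have hn0 : (1 / ((n : NNReal) + 1) : NNReal) ≠ 0 := by positivity
    have hc := hω.concave.2 (Set.mem_univ (((n : ℝ≥0∞) + 1) * ENNReal.ofReal t))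
      (Set.mem_univ (0 : ℝ≥0∞))
      (zero_le : 0 ≤ (1 / ((n : NNReal) + 1) : NNReal))
      (zero_le : 0 ≤ 1 - (1 / ((n : NNReal) + 1) : NNReal)) (add_tsub_cancel_of_le hn)
    have harg : (1 / ((n : NNReal) + 1) : NNReal) • (((n : ℝ≥0∞) + 1) * ENNReal.ofReal t)
        = ENNReal.ofReal t := by
      have h1 : ((n : ℝ≥0∞) + 1) = (((n : NNReal) + 1 : NNReal) : ℝ≥0∞) := by push_cast; rfl
      rw [ENNReal.smul_def, smul_eq_mul, ← mul_assoc, h1, ← ENNReal.coe_mul,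
        one_div_mul_cancel (by positivity), ENNReal.coe_one, one_mul]
    simp only [harg, h, hω.map_zero, smul_zero, add_zero] at hc
    have h2 := le_antisymm hc zero_le
    rw [ENNReal.smul_def, smul_eq_mul, mul_eq_zero] at h2
    rcases h2 with h2 | h2
    · exact absurd (ENNReal.coe_eq_zero.mp h2) hn0
    · exact h2
  have htop : ω ∞ = 0 := by
    have hp : ENNReal.ofReal t ≠ 0 := by simpa using ht
    have h1 : Filter.Tendsto (fun n : ℕ => ((n : ℝ≥0∞) + 1) * ENNReal.ofReal t)
        Filter.atTop (nhds ∞) := by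
      have h2 : Filter.Tendsto (fun n : ℕ => ((n : ℝ≥0∞) + 1)) Filter.atTop (nhds ∞) := by
        have h3 := (Filter.tendsto_add_atTop_iff_nat 1).mpr ENNReal.tendsto_nat_nhds_top
        simpa using h3
      have h4 := ENNReal.Tendsto.mul_const h2 (Or.inl ENNReal.top_ne_zero)
        (b := ENNReal.ofReal t)
      rwa [ENNReal.top_mul hp] at h4
    have h2 := (hω.continuous.tendsto ∞).comp h1
    have h3 : (ω ∘ fun n : ℕ => ((n : ℝ≥0∞) + 1) * ENNReal.ofReal t) = fun _ => 0 := by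
      funext n
      exact key n
    rw [h3] at h2
    exact (tendsto_nhds_unique tendsto_const_nhds h2).symm
  exact hs (le_antisymm (htop ▸ hω.monotone le_top) zero_le)

/-- Maps `ℝ → E` of class `C^{m,ω}`: `C^m` maps for which the supremum over `a ≠ b` of
`‖D^m f(b) - D^m f(a)‖ / ω(|b - a|)` is finite. The denominators are positive real numbers by
`IsModulus.modVal_pos`. -/
def IsCmOmega {E : Type*} [NormedAddCommGroup E] [NormedSpace ℝ E]
    (m : ℕ) (ω : ℝ≥0∞ → ℝ≥0∞) (f : ℝ → E) : Prop :=
  ContDiff ℝ m f ∧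
    ∃ C : ℝ, ∀ a b : ℝ, a ≠ b →
      ‖iteratedDeriv m f b - iteratedDeriv m f a‖ ≤ C * modVal ω |b - a|

/-- The horizontal vector field `X = ∂_x + 2 y ∂_t` of the first Heisenberg group. -/
def fieldX (p : EuclideanSpace ℝ (Fin 3)) : EuclideanSpace ℝ (Fin 3) := !₂[1, 0, 2 * p 1]

/-- The horizontal vector field `Y = ∂_y - 2 x ∂_t` of the first Heisenberg group. -/
def fieldY (p : EuclideanSpace ℝ (Fin 3)) : EuclideanSpace ℝ (Fin 3) := !₂[0, 1, -2 * p 0]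

/-- A curve is horizontal if it is absolutely continuous (on every compact interval) and, at
almost every time, its derivative is a linear combination of `X` and `Y` at the current point. -/
def IsHorizontalCurve (γ : ℝ → EuclideanSpace ℝ (Fin 3)) : Prop :=
  (∀ a b : ℝ, AbsolutelyContinuousOnInterval γ a b) ∧
    ∀ᵐ t : ℝ, deriv γ t ∈ Submodule.span ℝ {fieldX (γ t), fieldY (γ t)}

/-- The Taylor polynomial `T_a^m F (x) = ∑_{k ≤ m} F^k(a) / k! (x - a)^k` of a jet `F`.
A jet is given by functions `F k : ℝ → ℝ`, of which only the values on `K` for `k ≤ m` are used. -/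
def taylorPoly (m : ℕ) (F : ℕ → ℝ → ℝ) (a : ℝ) : ℝ[X] :=
  ∑ k ∈ Finset.range (m + 1), Polynomial.C (F k a / (k ! : ℝ)) * (Polynomial.X - Polynomial.C a) ^ k

/-- Whitney fields of class `C^{m,ω}` on `K`. Here `T_a^{m-k} F^k` is the Taylor polynomial of the
shifted jet `(F^k, F^{k+1}, …, F^m)`. -/
def IsWhitneyField (m : ℕ) (ω : ℝ≥0∞ → ℝ≥0∞) (K : Set ℝ) (F : ℕ → ℝ → ℝ) : Prop :=
  ∃ C : ℝ, 0 < C ∧ ∀ k ≤ m, ∀ a ∈ K, ∀ b ∈ K,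
    |F k b - (taylorPoly (m - k) (fun l => F (k + l)) a).eval b| ≤
      C * modVal ω |b - a| * |b - a| ^ (m - k)

/-- The area discrepancy `A(a, b)` of `(F, G, H)`; only `H^0` enters. -/
def areaDiscrepancy (m : ℕ) (F G H : ℕ → ℝ → ℝ) (a b : ℝ) : ℝ :=
  H 0 b - H 0 a
    - 2 * (∫ x in a..b,
        ((taylorPoly m F a).derivative.eval x * (taylorPoly m G a).eval x
          - (taylorPoly m G a).derivative.eval x * (taylorPoly m F a).eval x))
    + 2 * F 0 a * (G 0 b - (taylorPoly m G a).eval b)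
    - 2 * G 0 a * (F 0 b - (taylorPoly m F a).eval b)

/-- The velocity `V_ω(a, b)` of `(F, G)`. -/
def velocity (m : ℕ) (ω : ℝ≥0∞ → ℝ≥0∞) (F G : ℕ → ℝ → ℝ) (a b : ℝ) : ℝ :=
  modVal ω (b - a) ^ 2 * (b - a) ^ (2 * m)
    + modVal ω (b - a) * (b - a) ^ m *
      (∫ x in a..b, (|(taylorPoly m F a).derivative.eval x|
        + |(taylorPoly m G a).derivative.eval x|))

end HeisWhitney

end

/-! A `C^m` curve (f, g, h) with m ≥ 1 is horizontal exactly when h' = 2 (f' g - g' f), so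
increments of h are, up to the factor 2, areas swept by (f, g).

Necessity. Taylor's formula gives the Whitney conditions and the Leibniz rule gives condition 2. For
condition 3 write f = P + u, g = Q + v, with P, Q the Taylor polynomials at a. Then u, v = O(W) with
W = ω(b - a)(b - a)^m. Integration by parts (`area_perturbation`) expresses A(a, b) through terms in
which u, v are paired with P', Q' or with each other, and these are O(V) (`abs_areaDiscrepancy_le`).

Sufficiency. Two rays carrying the zero jet are added to K, so that the complement consists of
bounded gaps. A gap is rescaled to [0, 1], where polynomials p, q with the right jets at both ends
and ∫ (p' q - q' p) equal to half the increment of H are needed (`exists_gap_polynomials`).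
Interpolating the end jets perturbs the Taylor polynomials by O(W) and leaves an area error O(W (W +
‖P'‖ + ‖Q'‖)), by condition 3. The error is removed by adding λ η p' to q, where η = (x (1 -
x))^(m+1): the area changes by 2 λ ∫ η p'^2, which is at least of order λ ‖p'‖^2 since norms on
polynomials of bounded degree are equivalent (`exists_area_correction_of_le`). Hence the correction
is again O(W).

Derivatives of order m + 1 of the perturbed polynomials are then O(W) on [0, 1], and by concavity of
ω the rescaled pieces have m-th derivatives with modulus ω, uniformly over the gaps
(`gapFun_modulus`). Gluing preserves differentiability and the modulus (`hasDerivAt_of_gaps`,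
`hasModulus_of_gaps`); h is the primitive of 2 (f' g - g' f), which fits H at both ends of each gap
by the choice of area. -/

namespace HeisWhitney

/-! ### Moduli of continuity as real functions. -/

section Modulus

variable {ω : ℝ≥0∞ → ℝ≥0∞}

theorem modVal_nonneg (ω : ℝ≥0∞ → ℝ≥0∞) (t : ℝ) : 0 ≤ modVal ω t := ENNReal.toReal_nonneg

theorem IsModulus.modVal_zero (hω : IsModulus ω) : modVal ω 0 = 0 := by
  simp [modVal, hω.map_zero]

theorem IsModulus.modVal_mono (hω : IsModulus ω) {s t : ℝ} (h : s ≤ t) :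
    modVal ω s ≤ modVal ω t :=
  ENNReal.toReal_mono (hω.ne_top ENNReal.ofReal_ne_top)
    (hω.monotone (ENNReal.ofReal_le_ofReal h))

/-- Concavity together with ω(0) = 0 makes ω(t)/t decreasing; the form without denominators also
covers s = 0. -/
theorem IsModulus.mul_modVal_le (hω : IsModulus ω) {s t : ℝ} (hs : 0 ≤ s) (h : s ≤ t) :
    s * modVal ω t ≤ t * modVal ω s := by
  rcases hs.eq_or_lt with rfl | hs
  · simpa using mul_nonneg h (modVal_nonneg ω 0)
  have ht : 0 < t := hs.trans_le h
  set α : NNReal := Real.toNNReal (s / t) with hα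
  have hα1 : α ≤ 1 := by
    rw [hα, Real.toNNReal_le_one]
    exact (div_le_one ht).2 h
  have hc := hω.concave.2 (Set.mem_univ (ENNReal.ofReal t)) (Set.mem_univ (0 : ℝ≥0∞))
      (zero_le : 0 ≤ α) (zero_le : 0 ≤ 1 - α) (add_tsub_cancel_of_le hα1)
  have hαt : α • ENNReal.ofReal t = ENNReal.ofReal s := by
    rw [ENNReal.smul_def, smul_eq_mul, hα, ← ENNReal.ofReal, ← ENNReal.ofReal_mul (by positivity),
      div_mul_cancel₀ _ ht.ne']
  simp only [hω.map_zero, smul_zero, add_zero, hαt] at hc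
  have h2 := ENNReal.toReal_mono (hω.ne_top ENNReal.ofReal_ne_top) hc
  rw [ENNReal.smul_def, smul_eq_mul, ENNReal.toReal_mul, ENNReal.coe_toReal, hα,
    Real.coe_toNNReal _ (by positivity)] at h2
  change s / t * modVal ω t ≤ modVal ω s at h2
  rw [div_mul_eq_mul_div, div_le_iff₀ ht] at h2
  linarith

theorem IsModulus.tendsto_modVal (hω : IsModulus ω) :
    Filter.Tendsto (modVal ω) (nhds 0) (nhds 0) := by
  have h1 : Filter.Tendsto (fun t : ℝ => ω (ENNReal.ofReal t)) (nhds 0) (nhds 0) := by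
    have := (hω.continuous.comp ENNReal.continuous_ofReal).tendsto 0
    simpa [hω.map_zero, Function.comp_def] using this
  have := (ENNReal.tendsto_toReal ENNReal.zero_ne_top).comp h1
  rwa [ENNReal.toReal_zero] at this

/-- Real functions with modulus of continuity a multiple of `ω`. -/
def HasModulus (ω : ℝ≥0∞ → ℝ≥0∞) (f : ℝ → ℝ) : Prop :=
  ∃ C : ℝ, 0 < C ∧ ∀ a b : ℝ, |f b - f a| ≤ C * modVal ω |b - a|

theorem HasModulus.continuous (hω : IsModulus ω) {f : ℝ → ℝ} (hf : HasModulus ω f) :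
    Continuous f := by
  obtain ⟨C, -, hC⟩ := hf
  refine continuous_iff_continuousAt.2 fun a => ?_
  rw [ContinuousAt, tendsto_iff_dist_tendsto_zero]
  have h1 : Filter.Tendsto (fun b => |b - a|) (nhds a) (nhds 0) := by
    have : Continuous fun b : ℝ => |b - a| := by fun_prop
    simpa using this.tendsto a
  have h2 : Filter.Tendsto (fun b => C * modVal ω |b - a|) (nhds a) (nhds 0) := by
    simpa using (hω.tendsto_modVal.comp h1).const_mul C
  refine squeeze_zero (fun _ => dist_nonneg) (fun b => ?_) h2
  rw [Real.dist_eq]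
  exact hC a b

end Modulus

/-! ### Taylor polynomials of jets and Taylor's formula. -/

section Taylor

open Polynomial

theorem taylorPoly_eval (m : ℕ) (F : ℕ → ℝ → ℝ) (a x : ℝ) :
    (taylorPoly m F a).eval x = ∑ k ∈ Finset.range (m + 1), F k a / (k ! : ℝ) * (x - a) ^ k := by
  simp [taylorPoly, eval_finsetSum]

theorem taylorPoly_eval_self (m : ℕ) (F : ℕ → ℝ → ℝ) (a : ℝ) :
    (taylorPoly m F a).eval a = F 0 a := by
  rw [taylorPoly_eval, Finset.sum_range_succ']
  simp

/-- The shift is written `1 + k` to agree with the jets `fun l => F (k + l)` in `IsWhitneyField`. -/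
theorem derivative_taylorPoly_succ (m : ℕ) (F : ℕ → ℝ → ℝ) (a : ℝ) :
    derivative (taylorPoly (m + 1) F a) = taylorPoly m (fun k => F (1 + k)) a := by
  unfold taylorPoly
  rw [derivative_sum, Finset.sum_range_succ']
  simp only [pow_zero, mul_one, derivative_C, add_zero]
  refine Finset.sum_congr rfl fun k _ => ?_
  rw [derivative_C_mul, derivative_X_sub_C_pow, Nat.add_sub_cancel, ← mul_assoc, add_comm 1 k]
  congr 1
  rw [← C_mul, Nat.factorial_succ]
  congr 1
  push_cast
  have : (k ! : ℝ) ≠ 0 := by positivity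
  field_simp

theorem iterate_derivative_taylorPoly (m k : ℕ) (hk : k ≤ m) (F : ℕ → ℝ → ℝ) (a : ℝ) :
    derivative^[k] (taylorPoly m F a) = taylorPoly (m - k) (fun l => F (k + l)) a := by
  induction k with
  | zero => simp
  | succ k ih =>
    rw [Function.iterate_succ_apply', ih (by omega), show m - k = m - (k + 1) + 1 by omega,
      derivative_taylorPoly_succ]
    simp only [add_assoc]

theorem natDegree_taylorPoly_le (m : ℕ) (F : ℕ → ℝ → ℝ) (a : ℝ) :
    (taylorPoly m F a).natDegree ≤ m := by
  unfold taylorPoly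
  refine natDegree_sum_le_of_forall_le _ _ fun k hk => ?_
  refine (natDegree_C_mul_le _ _).trans ?_
  rw [natDegree_pow, natDegree_X_sub_C]
  have := Finset.mem_range.1 hk
  omega

/-- Taylor's formula with remainder controlled by the modulus of continuity of the top
derivative. -/
theorem taylor_remainder_le {ω : ℝ≥0∞ → ℝ≥0∞} (hω : IsModulus ω) {C : ℝ} (hC : 0 ≤ C) (n : ℕ) :
    ∀ f : ℕ → ℝ → ℝ, (∀ k < n, ∀ x, HasDerivAt (f k) (f (k + 1) x) x) →
      (∀ a b, |f n b - f n a| ≤ C * modVal ω |b - a|) →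
      ∀ a b, |f 0 b - (taylorPoly n f a).eval b| ≤ C * modVal ω |b - a| * |b - a| ^ n := by
  induction n with
  | zero =>
    intro f _ hf a b
    simpa [taylorPoly_eval] using hf a b
  | succ n ih =>
    intro f hd hf a b
    have key := ih (fun k => f (1 + k))
      (fun k hk x => by have := hd (1 + k) (by omega) x; rwa [add_assoc] at this)
      (by rwa [add_comm n 1] at hf)
    -- The derivative of the remainder is the remainder, of one order less, of the shifted sequence;
    -- with ω frozen at |b - a|, the mean value inequality supplies the missing factor |b - a|.
    have hder : ∀ x ∈ Set.uIcc a b, HasDerivWithinAt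
        (fun x => f 0 x - (taylorPoly (n + 1) f a).eval x)
        (f 1 x - (taylorPoly n (fun k => f (1 + k)) a).eval x) (Set.uIcc a b) x := by
      intro x _
      have h1 := (taylorPoly (n + 1) f a).hasDerivAt x
      rw [derivative_taylorPoly_succ] at h1
      exact ((hd 0 (by omega) x).sub h1).hasDerivWithinAt
    have hbd : ∀ x ∈ Set.uIcc a b, ‖f 1 x - (taylorPoly n (fun k => f (1 + k)) a).eval x‖ ≤
        C * modVal ω |b - a| * |b - a| ^ n := by
      intro x hx
      have hxa : |x - a| ≤ |b - a| := Set.abs_sub_left_of_mem_uIcc hx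
      refine (key a x).trans ?_
      have := hω.modVal_mono hxa
      have := modVal_nonneg ω |b - a|
      gcongr
    have := (convex_uIcc a b).norm_image_sub_le_of_norm_hasDerivWithin_le hder hbd
      Set.left_mem_uIcc Set.right_mem_uIcc
    simp only [taylorPoly_eval_self, sub_self, sub_zero, Real.norm_eq_abs] at this
    rw [pow_succ, ← mul_assoc]
    exact this

theorem isWhitneyField_of_hasDerivAt {ω : ℝ≥0∞ → ℝ≥0∞} (hω : IsModulus ω) {m : ℕ}
    {f : ℕ → ℝ → ℝ} (hd : ∀ k < m, ∀ x, HasDerivAt (f k) (f (k + 1) x) x)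
    (hf : HasModulus ω (f m)) (K : Set ℝ) : IsWhitneyField m ω K f := by
  obtain ⟨C, hC, h⟩ := hf
  refine ⟨C, hC, fun k hk a _ b _ => ?_⟩
  exact taylor_remainder_le hω hC.le (m - k) (fun l => f (k + l))
    (fun l hl x => hd (k + l) (by omega) x) (by simpa [Nat.add_sub_cancel' hk] using h) a b

end Taylor

/-! ### Curves of class `C^{m,ω}` in coordinates, and the Leibniz formula for the third one. -/

section Jets

/-- `f 0` is of class `C^{m,ω}` with derivatives `f k`, `k ≤ m`. -/
def IsJet (m : ℕ) (ω : ℝ≥0∞ → ℝ≥0∞) (f : ℕ → ℝ → ℝ) : Prop :=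
  (∀ k < m, ∀ x, HasDerivAt (f k) (f (k + 1) x) x) ∧ HasModulus ω (f m)

theorem IsJet.continuous {m : ℕ} {ω : ℝ≥0∞ → ℝ≥0∞} (hω : IsModulus ω) {f : ℕ → ℝ → ℝ}
    (hf : IsJet m ω f) {k : ℕ} (hk : k ≤ m) : Continuous (f k) := by
  rcases hk.lt_or_eq with hk | rfl
  · exact continuous_iff_continuousAt.2 fun x => (hf.1 k hk x).continuousAt
  · exact hf.2.continuous hω

theorem IsCmOmega.isJet {m : ℕ} {ω : ℝ≥0∞ → ℝ≥0∞} (hω : IsModulus ω)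
    {Γ : ℝ → EuclideanSpace ℝ (Fin 3)} (hΓ : IsCmOmega m ω Γ) (i : Fin 3) :
    IsJet m ω (fun k x => iteratedDeriv k Γ x i) := by
  constructor
  · intro k hk x
    have h1 : DifferentiableAt ℝ (iteratedDeriv k Γ) x :=
      (hΓ.1.differentiable_iteratedDeriv k (by exact_mod_cast hk)) x
    have h2 := h1.hasDerivAt
    rw [← iteratedDeriv_succ] at h2
    exact ((EuclideanSpace.proj (𝕜 := ℝ) i).hasFDerivAt.comp_hasDerivAt x h2)
  · obtain ⟨C, hC⟩ := hΓ.2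
    refine ⟨max C 1, by positivity, fun a b => ?_⟩
    rcases eq_or_ne a b with rfl | hab
    · simp [hω.modVal_zero]
    calc |iteratedDeriv m Γ b i - iteratedDeriv m Γ a i|
        ≤ ‖iteratedDeriv m Γ b - iteratedDeriv m Γ a‖ := by
          have := PiLp.norm_apply_le (iteratedDeriv m Γ b - iteratedDeriv m Γ a) i
          simpa using this
      _ ≤ C * modVal ω |b - a| := hC a b hab
      _ ≤ max C 1 * modVal ω |b - a| := by
          have := modVal_nonneg ω |b - a|
          gcongr
          exact le_max_left _ _

theorem hasDerivAt_vec3 {f g h : ℝ → ℝ} {f' g' h' x : ℝ} (hf : HasDerivAt f f' x)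
    (hg : HasDerivAt g g' x) (hh : HasDerivAt h h' x) :
    HasDerivAt (fun x => (!₂[f x, g x, h x] : EuclideanSpace ℝ (Fin 3)))
      (!₂[f', g', h']) x := by
  have h1 : HasDerivAt (fun x => (![f x, g x, h x] : Fin 3 → ℝ)) ![f', g', h'] x := by
    rw [hasDerivAt_pi]
    intro i
    fin_cases i
    · exact hf
    · exact hg
    · exact hh
  exact (PiLp.continuousLinearEquiv 2 ℝ (fun _ : Fin 3 => ℝ)).symm.hasFDerivAt.comp_hasDerivAt x h1

theorem iteratedDeriv_vec3 {m : ℕ} {f g h : ℕ → ℝ → ℝ}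
    (hf : ∀ k < m, ∀ x, HasDerivAt (f k) (f (k + 1) x) x)
    (hg : ∀ k < m, ∀ x, HasDerivAt (g k) (g (k + 1) x) x)
    (hh : ∀ k < m, ∀ x, HasDerivAt (h k) (h (k + 1) x) x) :
    ∀ k ≤ m, iteratedDeriv k (fun x => (!₂[f 0 x, g 0 x, h 0 x] : EuclideanSpace ℝ (Fin 3))) =
      fun x => !₂[f k x, g k x, h k x] := by
  intro k
  induction k with
  | zero => simp
  | succ k ih =>
    intro hk
    rw [iteratedDeriv_succ, ih (by omega)]
    funext x
    exact (hasDerivAt_vec3 (hf k hk x) (hg k hk x) (hh k hk x)).deriv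

theorem norm_vec3_le (a b c : ℝ) :
    ‖(!₂[a, b, c] : EuclideanSpace ℝ (Fin 3))‖ ≤ |a| + |b| + |c| := by
  rw [EuclideanSpace.norm_eq]
  refine Real.sqrt_le_iff.2 ⟨by positivity, ?_⟩
  simp only [Fin.sum_univ_three, Real.norm_eq_abs]
  change |a| ^ 2 + |b| ^ 2 + |c| ^ 2 ≤ _
  nlinarith [mul_nonneg (abs_nonneg a) (abs_nonneg b), mul_nonneg (abs_nonneg a) (abs_nonneg c),
    mul_nonneg (abs_nonneg b) (abs_nonneg c)]

theorem isCmOmega_vec3 {m : ℕ} {ω : ℝ≥0∞ → ℝ≥0∞} (hω : IsModulus ω) {f g h : ℕ → ℝ → ℝ}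
    (hf : IsJet m ω f) (hg : IsJet m ω g) (hh : IsJet m ω h) :
    IsCmOmega m ω (fun x => (!₂[f 0 x, g 0 x, h 0 x] : EuclideanSpace ℝ (Fin 3))) := by
  have hit := iteratedDeriv_vec3 hf.1 hg.1 hh.1
  constructor
  · rw [contDiff_nat_iff_iteratedDeriv]
    constructor
    · intro k hk
      rw [hit k hk]
      have h1 : Continuous (fun x => (![f k x, g k x, h k x] : Fin 3 → ℝ)) := by
        refine continuous_pi fun i => ?_
        fin_cases i
        · exact hf.continuous hω hk
        · exact hg.continuous hω hk
        · exact hh.continuous hω hk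
      exact (PiLp.continuousLinearEquiv 2 ℝ (fun _ : Fin 3 => ℝ)).symm.continuous.comp h1
    · intro k hk x
      rw [hit k hk.le]
      exact (hasDerivAt_vec3 (hf.1 k hk x) (hg.1 k hk x) (hh.1 k hk x)).differentiableAt
  · obtain ⟨C₁, -, h1⟩ := hf.2
    obtain ⟨C₂, -, h2⟩ := hg.2
    obtain ⟨C₃, -, h3⟩ := hh.2
    refine ⟨C₁ + C₂ + C₃, fun a b _ => ?_⟩
    rw [hit m le_rfl]
    have : (!₂[f m b, g m b, h m b] - !₂[f m a, g m a, h m a] : EuclideanSpace ℝ (Fin 3)) =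
        !₂[f m b - f m a, g m b - g m a, h m b - h m a] := by
      ext i
      fin_cases i <;> rfl
    dsimp only
    rw [this]
    refine (norm_vec3_le _ _ _).trans ?_
    linarith [h1 a b, h2 a b, h3 a b]

/-- The `k`-th derivative, `k ≥ 1`, of a primitive of `2 (f' g - g' f)`. -/
def liftDeriv (f g : ℕ → ℝ → ℝ) (k : ℕ) (x : ℝ) : ℝ :=
  2 * ∑ i ∈ Finset.range k, ((k - 1).choose i : ℝ) * (f (k - i) x * g i x - g (k - i) x * f i x)

theorem liftDeriv_one (f g : ℕ → ℝ → ℝ) (x : ℝ) :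
    liftDeriv f g 1 x = 2 * (f 1 x * g 0 x - g 1 x * f 0 x) := by
  simp [liftDeriv]

/-- The sum is the n-th derivative of f' g, and differentiating it is Pascal's rule. The term i = 0
contains `f (n + 1)`, whence `n + 1 < m`. -/
theorem hasDerivAt_leibniz_sum {m : ℕ} {f g : ℕ → ℝ → ℝ}
    (hf : ∀ k < m, ∀ x, HasDerivAt (f k) (f (k + 1) x) x)
    (hg : ∀ k < m, ∀ x, HasDerivAt (g k) (g (k + 1) x) x) {n : ℕ} (hn : n + 1 < m) (x : ℝ) :
    HasDerivAt (fun x => ∑ i ∈ Finset.range (n + 1), (n.choose i : ℝ) * (f (n + 1 - i) x * g i x))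
      (∑ i ∈ Finset.range (n + 2), ((n + 1).choose i : ℝ) * (f (n + 2 - i) x * g i x)) x := by
  have h1 : HasDerivAt
      (fun x => ∑ i ∈ Finset.range (n + 1), (n.choose i : ℝ) * (f (n + 1 - i) x * g i x))
      (∑ i ∈ Finset.range (n + 1), (n.choose i : ℝ) *
        (f (n + 1 - i + 1) x * g i x + f (n + 1 - i) x * g (i + 1) x)) x := by
    refine HasDerivAt.fun_sum fun i hi => ?_
    have := Finset.mem_range.1 hi
    exact ((hf _ (by omega) x).mul (hg _ (by omega) x)).const_mul _
  convert h1 using 1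
  have h2 := Finset.sum_antidiagonal_choose_succ_mul (R := ℝ) (fun i j => f (j + 1) x * g i x) n
  rw [Finset.Nat.sum_antidiagonal_eq_sum_range_succ
      (fun i j => ((n + 1).choose i : ℝ) * (f (j + 1) x * g i x)),
    Finset.Nat.sum_antidiagonal_eq_sum_range_succ
      (fun i j => (n.choose i : ℝ) * (f (j + 1 + 1) x * g i x)),
    Finset.Nat.sum_antidiagonal_eq_sum_range_succ
      (fun i j => (n.choose j : ℝ) * (f (j + 1) x * g (i + 1) x)), ← Finset.sum_add_distrib] at h2
  convert h2 using 1
  · refine Finset.sum_congr rfl fun i hi => ?_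
    have := Finset.mem_range.1 hi
    rw [show n + 2 - i = n + 1 - i + 1 by omega]
  · refine Finset.sum_congr rfl fun i hi => ?_
    have := Finset.mem_range.1 hi
    rw [Nat.choose_symm (by omega), show n + 1 - i = n - i + 1 by omega]
    ring

theorem hasDerivAt_liftDeriv {m : ℕ} {f g : ℕ → ℝ → ℝ}
    (hf : ∀ k < m, ∀ x, HasDerivAt (f k) (f (k + 1) x) x)
    (hg : ∀ k < m, ∀ x, HasDerivAt (g k) (g (k + 1) x) x) {k : ℕ} (hk : 1 ≤ k) (hkm : k < m)
    (x : ℝ) : HasDerivAt (liftDeriv f g k) (liftDeriv f g (k + 1) x) x := by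
  obtain ⟨n, rfl⟩ : ∃ n, k = n + 1 := ⟨k - 1, by omega⟩
  have h := ((hasDerivAt_leibniz_sum hf hg hkm x).sub
    (hasDerivAt_leibniz_sum hg hf hkm x)).const_mul 2
  have e : ∀ k, liftDeriv f g (k + 1) = fun y =>
      2 * (∑ i ∈ Finset.range (k + 1), (k.choose i : ℝ) * (f (k + 1 - i) y * g i y) -
        ∑ i ∈ Finset.range (k + 1), (k.choose i : ℝ) * (g (k + 1 - i) y * f i y)) := by
    intro k
    funext y
    simp [liftDeriv, mul_sub, Finset.sum_sub_distrib]
  rw [e, e]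
  exact h

end Jets

/-! ### Horizontality and the area estimate for a given curve. -/

section Necessity

/-- The contact equation holds almost everywhere, and both sides are continuous, so it holds
everywhere. -/
theorem IsHorizontalCurve.deriv_eq {Γ : ℝ → EuclideanSpace ℝ (Fin 3)}
    (hΓ : IsHorizontalCurve Γ) (hc : ContDiff ℝ 1 Γ) (x : ℝ) :
    deriv Γ x 2 = 2 * (deriv Γ x 0 * Γ x 1 - deriv Γ x 1 * Γ x 0) := by
  have h1 : (fun x => deriv Γ x 2) =ᵐ[volume]
      fun x => 2 * (deriv Γ x 0 * Γ x 1 - deriv Γ x 1 * Γ x 0) := by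
    filter_upwards [hΓ.2] with x hx
    obtain ⟨a, b, hab⟩ := Submodule.mem_span_pair.1 hx
    rw [← hab]
    simp [fieldX, fieldY]
    ring
  have hd : Continuous (deriv Γ) := hc.continuous_deriv le_rfl
  have hd' : ∀ i, Continuous fun x => deriv Γ x i := fun i => by fun_prop
  have hΓ' : ∀ i, Continuous fun x => Γ x i := fun i => by
    have := hc.continuous
    fun_prop
  have h2 := (Continuous.ae_eq_iff_eq volume (hd' 2) (by
    have := hd' 0; have := hd' 1; have := hΓ' 0; have := hΓ' 1
    fun_prop)).1 h1
  exact congrFun h2 x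

theorem isHorizontalCurve_vec3 {f g h f' g' : ℝ → ℝ} (hf : ∀ x, HasDerivAt f (f' x) x)
    (hg : ∀ x, HasDerivAt g (g' x) x)
    (hh : ∀ x, HasDerivAt h (2 * (f' x * g x - g' x * f x)) x) (hf' : Continuous f')
    (hg' : Continuous g') :
    IsHorizontalCurve (fun x => (!₂[f x, g x, h x] : EuclideanSpace ℝ (Fin 3))) := by
  have hd := fun x => hasDerivAt_vec3 (hf x) (hg x) (hh x)
  have hfc : Continuous f := continuous_iff_continuousAt.2 fun x => (hf x).continuousAt
  have hgc : Continuous g := continuous_iff_continuousAt.2 fun x => (hg x).continuousAt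
  constructor
  · intro a b
    refine ContDiffOn.absolutelyContinuousOnInterval (ContDiff.contDiffOn ?_)
    rw [contDiff_one_iff_deriv]
    refine ⟨fun x => (hd x).differentiableAt, ?_⟩
    have : deriv (fun x => (!₂[f x, g x, h x] : EuclideanSpace ℝ (Fin 3))) =
        fun x => !₂[f' x, g' x, 2 * (f' x * g x - g' x * f x)] := funext fun x => (hd x).deriv
    rw [this]
    have h1 : Continuous (fun x => (![f' x, g' x, 2 * (f' x * g x - g' x * f x)] : Fin 3 → ℝ)) := by
      refine continuous_pi fun i => ?_
      fin_cases i
      · exact hf'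
      · exact hg'
      · change Continuous fun x => 2 * (f' x * g x - g' x * f x)
        fun_prop
    exact (PiLp.continuousLinearEquiv 2 ℝ (fun _ : Fin 3 => ℝ)).symm.continuous.comp h1
  · refine Filter.Eventually.of_forall fun x => ?_
    rw [(hd x).deriv, Submodule.mem_span_pair]
    refine ⟨f' x, g' x, ?_⟩
    ext i
    fin_cases i
    · simp [fieldX, fieldY]
    · simp [fieldX, fieldY]
    · simp [fieldX, fieldY]
      ring

/-- Integration by parts for the area swept by a perturbation of the pair `(P, Q)`. -/
theorem area_perturbation {P Q u v P' Q' u' v' h : ℝ → ℝ} {a b : ℝ}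
    (hP : ∀ x, HasDerivAt P (P' x) x) (hQ : ∀ x, HasDerivAt Q (Q' x) x)
    (hu : ∀ x, HasDerivAt u (u' x) x) (hv : ∀ x, HasDerivAt v (v' x) x)
    (hP' : Continuous P') (hQ' : Continuous Q') (hu' : Continuous u') (hv' : Continuous v')
    (hua : u a = 0) (hva : v a = 0)
    (hh : ∀ x, HasDerivAt h
      (2 * ((P' x + u' x) * (Q x + v x) - (Q' x + v' x) * (P x + u x))) x) :
    h b - h a - 2 * (∫ x in a..b, P' x * Q x - Q' x * P x) + 2 * P a * v b - 2 * Q a * u b =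
      (∫ x in a..b, 4 * (P' x * v x - Q' x * u x) + 2 * (u' x * v x - v' x * u x)) +
        2 * u b * (Q b - Q a) - 2 * v b * (P b - P a) := by
  have hPc : Continuous P := continuous_iff_continuousAt.2 fun x => (hP x).continuousAt
  have hQc : Continuous Q := continuous_iff_continuousAt.2 fun x => (hQ x).continuousAt
  have huc : Continuous u := continuous_iff_continuousAt.2 fun x => (hu x).continuousAt
  have hvc : Continuous v := continuous_iff_continuousAt.2 fun x => (hv x).continuousAt
  -- Subtracting 2 (u Q - v P) cancels u' Q and v' P, in which P and Q are not differentiated and so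
  -- are not controlled by the velocity, and doubles P' v and Q' u.
  have hΦ : ∀ x, HasDerivAt (fun x => h x - 2 * (u x * Q x - v x * P x))
      (2 * (P' x * Q x - Q' x * P x) +
        (4 * (P' x * v x - Q' x * u x) + 2 * (u' x * v x - v' x * u x))) x := by
    intro x
    have := (hh x).sub ((((hu x).mul (hQ x)).sub ((hv x).mul (hP x))).const_mul 2)
    refine this.congr_deriv ?_
    ring
  have h1 : Continuous fun x => P' x * Q x - Q' x * P x := by fun_prop
  have h2 : Continuous fun x =>
    4 * (P' x * v x - Q' x * u x) + 2 * (u' x * v x - v' x * u x) := by fun_prop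
  have key := intervalIntegral.integral_eq_sub_of_hasDerivAt (a := a) (b := b)
    (fun x _ => hΦ x) ((by fun_prop : Continuous _).intervalIntegrable _ _)
  rw [intervalIntegral.integral_add ((h1.const_mul 2).intervalIntegrable _ _)
    (h2.intervalIntegrable _ _), intervalIntegral.integral_const_mul] at key
  simp only [hua, hva] at key
  linarith

/-- With W = ω(l) l^m, l = b - a, and I = ∫ (|P'| + |Q'|), the velocity is W^2 + W I. The Taylor
remainders u, v are O(W) and u', v' are O(W / l). In `area_perturbation` the terms with P', Q' or
increments of P, Q are O(W I), and ∫ (u' v - v' u) is O(W^2), the length of the interval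
compensating 1 / l. -/
theorem abs_areaDiscrepancy_le {m : ℕ} (hm : 1 ≤ m) {ω : ℝ≥0∞ → ℝ≥0∞} (hω : IsModulus ω)
    {f g : ℕ → ℝ → ℝ} (hf : IsJet m ω f) (hg : IsJet m ω g) {H : ℕ → ℝ → ℝ}
    (hH : ∀ x, HasDerivAt (H 0) (2 * (f 1 x * g 0 x - g 1 x * f 0 x)) x) :
    ∃ C : ℝ, 1 ≤ C ∧ ∀ a b, a < b → |areaDiscrepancy m f g H a b| ≤ C * velocity m ω f g a b := by
  obtain ⟨n, rfl⟩ : ∃ n, m = n + 1 := ⟨m - 1, by omega⟩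
  obtain ⟨C₁, hC₁, h1⟩ := isWhitneyField_of_hasDerivAt hω hf.1 hf.2 Set.univ
  obtain ⟨C₂, hC₂, h2⟩ := isWhitneyField_of_hasDerivAt hω hg.1 hg.2 Set.univ
  set C := max C₁ C₂ with hC
  have hC0 : 0 < C := lt_max_of_lt_left hC₁
  -- The terms add up to 8 C W I + 4 C^2 W^2, and 8 C ≤ 1 + 6 C + 4 C^2.
  refine ⟨1 + 6 * C + 4 * C ^ 2, by nlinarith, fun a b hab => ?_⟩
  set P : ℝ[X] := taylorPoly (n + 1) f a with hP
  set Q : ℝ[X] := taylorPoly (n + 1) g a with hQ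
  set u := fun x => f 0 x - P.eval x with hu
  set v := fun x => g 0 x - Q.eval x with hv
  set u' := fun x => f 1 x - P.derivative.eval x with hu'
  set v' := fun x => g 1 x - Q.derivative.eval x with hv'
  have hfc : Continuous (f 1) := hf.continuous hω hm
  have hgc : Continuous (g 1) := hg.continuous hω hm
  have key := area_perturbation (a := a) (b := b) (P := fun x => P.eval x)
    (Q := fun x => Q.eval x) (u := u) (v := v)
    (P' := fun x => P.derivative.eval x) (Q' := fun x => Q.derivative.eval x) (u' := u')
    (v' := v') (h := H 0)
    (fun x => P.hasDerivAt x) (fun x => Q.hasDerivAt x)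
    (fun x => (hf.1 0 (by omega) x).sub (P.hasDerivAt x))
    (fun x => (hg.1 0 (by omega) x).sub (Q.hasDerivAt x))
    (by fun_prop) (by fun_prop) (by fun_prop) (by fun_prop)
    (by simp [hu, hP, taylorPoly_eval_self]) (by simp [hv, hQ, taylorPoly_eval_self])
    (fun x => by convert hH x using 2; simp [hu, hv, hu', hv'])
  set w := modVal ω (b - a) with hw
  have hw0 : 0 ≤ w := modVal_nonneg _ _
  set l := b - a with hl
  have hl0 : 0 < l := sub_pos.2 hab
  have hmod : ∀ x ∈ Set.Icc a b, modVal ω |x - a| ≤ w ∧ |x - a| ≤ l := by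
    intro x hx
    have h3 : |x - a| ≤ l := by
      rw [abs_of_nonneg (sub_nonneg.2 hx.1)]
      linarith [hx.2]
    exact ⟨hω.modVal_mono h3, h3⟩
  have bound0 : ∀ (θ : ℕ → ℝ → ℝ) (D : ℝ), 0 < D → D ≤ C →
      (∀ k ≤ n + 1, ∀ a ∈ Set.univ, ∀ b ∈ Set.univ,
        |θ k b - (taylorPoly (n + 1 - k) (fun l => θ (k + l)) a).eval b| ≤
          D * modVal ω |b - a| * |b - a| ^ (n + 1 - k)) → ∀ x ∈ Set.Icc a b,
      |θ 0 x - (taylorPoly (n + 1) θ a).eval x| ≤ C * w * l ^ (n + 1) ∧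
      |θ 1 x - (taylorPoly (n + 1) θ a).derivative.eval x| ≤ C * w * l ^ n := by
    intro θ D hD hDC hθ x hx
    obtain ⟨h4, h5⟩ := hmod x hx
    have h6 := modVal_nonneg ω |x - a|
    constructor
    · have := hθ 0 (by omega) a trivial x trivial
      simp only [Nat.sub_zero, zero_add] at this
      refine this.trans ?_
      gcongr
    · have := hθ 1 (by omega) a trivial x trivial
      rw [derivative_taylorPoly_succ]
      simp only [Nat.add_sub_cancel] at this
      refine this.trans ?_
      gcongr
  have bf := bound0 f C₁ hC₁ (le_max_left _ _) h1
  have bg := bound0 g C₂ hC₂ (le_max_right _ _) h2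
  set W := w * l ^ (n + 1) with hW
  have hW0 : 0 ≤ W := by positivity
  set I := ∫ x in a..b, (|P.derivative.eval x| + |Q.derivative.eval x|) with hI
  have hIint : IntervalIntegrable (fun x => |P.derivative.eval x| + |Q.derivative.eval x|)
    volume a b := (by fun_prop : Continuous _).intervalIntegrable _ _
  have hinc : ∀ R : ℝ[X], (∀ x, |R.derivative.eval x| ≤
      |P.derivative.eval x| + |Q.derivative.eval x|) → |R.eval b - R.eval a| ≤ I := by
    intro R hR
    have h7 := intervalIntegral.integral_eq_sub_of_hasDerivAt (a := a) (b := b)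
      (fun x _ => R.hasDerivAt x) ((by fun_prop : Continuous _).intervalIntegrable _ _)
    rw [← h7]
    exact intervalIntegral.norm_integral_le_of_norm_le (f := fun x => R.derivative.eval x) hab.le
      (Filter.Eventually.of_forall fun x _ => hR x) hIint
  have hPinc := hinc P fun x => le_add_of_nonneg_right (abs_nonneg _)
  have hQinc := hinc Q fun x => le_add_of_nonneg_left (abs_nonneg _)
  have hint : |∫ x in a..b, 4 * (P.derivative.eval x * v x - Q.derivative.eval x * u x) +
      2 * (u' x * v x - v' x * u x)| ≤ 4 * (C * W) * I + 4 * C ^ 2 * W ^ 2 := by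
    have h8 : ∀ x ∈ Set.Icc a b,
        |4 * (P.derivative.eval x * v x - Q.derivative.eval x * u x) +
          2 * (u' x * v x - v' x * u x)| ≤
        4 * (C * W) * (|P.derivative.eval x| + |Q.derivative.eval x|) +
          4 * (C * W * (C * w * l ^ n)) := by
      intro x hx
      obtain ⟨hf0, hf1⟩ := bf x hx
      obtain ⟨hg0, hg1⟩ := bg x hx
      change |u x| ≤ _ at hf0
      change |v x| ≤ _ at hg0
      change |u' x| ≤ _ at hf1
      change |v' x| ≤ _ at hg1
      rw [mul_assoc, ← hW] at hf0 hg0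
      have e1 : |P.derivative.eval x * v x| ≤ |P.derivative.eval x| * (C * W) := by
        rw [abs_mul]; gcongr
      have e2 : |Q.derivative.eval x * u x| ≤ |Q.derivative.eval x| * (C * W) := by
        rw [abs_mul]; gcongr
      have e3 : |u' x * v x| ≤ (C * w * l ^ n) * (C * W) := by
        rw [abs_mul]; gcongr
      have e4 : |v' x * u x| ≤ (C * w * l ^ n) * (C * W) := by
        rw [abs_mul]; gcongr
      rw [abs_le] at *
      constructor <;> linarith
    have h9 := intervalIntegral.norm_integral_le_of_norm_le (μ := volume)
      (f := fun x => 4 * (P.derivative.eval x * v x - Q.derivative.eval x * u x) +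
          2 * (u' x * v x - v' x * u x))
      (g := fun x => 4 * (C * W) * (|P.derivative.eval x| + |Q.derivative.eval x|) +
          4 * (C * W * (C * w * l ^ n))) hab.le
      (Filter.Eventually.of_forall fun x hx => h8 x ⟨hx.1.le, hx.2⟩)
      ((hIint.const_mul _).add intervalIntegrable_const)
    refine h9.trans (le_of_eq ?_)
    rw [intervalIntegral.integral_add (hIint.const_mul _) intervalIntegrable_const,
      intervalIntegral.integral_const_mul, intervalIntegral.integral_const, smul_eq_mul, ← hl]
    rw [hW, pow_succ]
    ring
  obtain ⟨hf0, -⟩ := bf b ⟨hab.le, le_rfl⟩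
  obtain ⟨hg0, -⟩ := bg b ⟨hab.le, le_rfl⟩
  change |u b| ≤ _ at hf0
  change |v b| ≤ _ at hg0
  rw [mul_assoc, ← hW] at hf0 hg0
  have hA : areaDiscrepancy (n + 1) f g H a b =
      (∫ x in a..b, 4 * (P.derivative.eval x * v x - Q.derivative.eval x * u x) +
        2 * (u' x * v x - v' x * u x)) +
      2 * u b * (Q.eval b - Q.eval a) - 2 * v b * (P.eval b - P.eval a) := by
    rw [← key]
    simp only [areaDiscrepancy, ← hP, ← hQ, hu, hv]
    simp only [hP, hQ, taylorPoly_eval_self]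
  have hV : velocity (n + 1) ω f g a b = W ^ 2 + W * I := by
    simp only [velocity, ← hP, ← hQ, ← hl, ← hw, ← hI, hW]
    ring
  have hI0 : 0 ≤ I := (abs_nonneg _).trans hPinc
  rw [hA, hV]
  have e1 : |2 * u b * (Q.eval b - Q.eval a)| ≤ 2 * (C * W) * I := by
    rw [abs_mul, abs_mul, abs_two]; gcongr
  have e2 : |2 * v b * (P.eval b - P.eval a)| ≤ 2 * (C * W) * I := by
    rw [abs_mul, abs_mul, abs_two]; gcongr
  have e3 : 0 ≤ C * W * I := by positivity
  have e4 : 0 ≤ C ^ 2 * W * I := by positivity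
  have e5 : 0 ≤ W ^ 2 := by positivity
  have e6 : 0 ≤ C * W ^ 2 := by positivity
  have e7 : 0 ≤ W * I := by positivity
  have e8 : 0 ≤ C ^ 2 * W ^ 2 := by positivity
  rw [abs_le] at *
  constructor <;> nlinarith
end Necessity

/-! ### The ℓ¹ norm of coefficients and integrals over the unit interval. -/

section CoefficientNorm

open Polynomial

/-- The sum of the absolute values of the coefficients. -/
def coeffNorm (p : ℝ[X]) : ℝ := p.sum fun _ c => |c|

theorem coeffNorm_eq_sum_range {p : ℝ[X]} {n : ℕ} (h : p.natDegree < n) :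
    coeffNorm p = ∑ i ∈ Finset.range n, |p.coeff i| :=
  p.sum_over_range' (fun _ => abs_zero) n h

theorem coeffNorm_nonneg (p : ℝ[X]) : 0 ≤ coeffNorm p :=
  Finset.sum_nonneg fun _ _ => abs_nonneg _

theorem coeffNorm_zero : coeffNorm 0 = 0 := by simp [coeffNorm]

theorem coeffNorm_pos {p : ℝ[X]} (hp : p ≠ 0) : 0 < coeffNorm p :=
  Finset.sum_pos (fun _ hi => abs_pos.2 (mem_support_iff.1 hi)) (support_nonempty.2 hp)

theorem coeffNorm_add_le (p q : ℝ[X]) : coeffNorm (p + q) ≤ coeffNorm p + coeffNorm q := by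
  set n := max (p + q).natDegree (max p.natDegree q.natDegree) + 1 with hn
  rw [coeffNorm_eq_sum_range (n := n) (by omega), coeffNorm_eq_sum_range (p := p) (n := n) (by omega),
    coeffNorm_eq_sum_range (p := q) (n := n) (by omega), ← Finset.sum_add_distrib]
  refine Finset.sum_le_sum fun i _ => ?_
  rw [coeff_add]
  exact abs_add_le _ _

theorem coeffNorm_monomial (n : ℕ) (c : ℝ) : coeffNorm (monomial n c) = |c| := by
  rw [coeffNorm, sum_monomial_index _ _ abs_zero]

theorem coeffNorm_sum_le {ι : Type*} (s : Finset ι) (f : ι → ℝ[X]) :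
    coeffNorm (∑ i ∈ s, f i) ≤ ∑ i ∈ s, coeffNorm (f i) :=
  Finset.le_sum_of_subadditive coeffNorm coeffNorm_zero.le coeffNorm_add_le s f

/-- Submultiplicativity is the reason for using the ℓ¹ norm: together with the bound of the supremum
on [0, 1] it estimates all integrals of products. -/
theorem coeffNorm_mul_le (p q : ℝ[X]) : coeffNorm (p * q) ≤ coeffNorm p * coeffNorm q := by
  rw [mul_eq_sum_sum]
  refine (coeffNorm_sum_le _ _).trans ?_
  rw [coeffNorm, Polynomial.sum, Finset.sum_mul]
  refine Finset.sum_le_sum fun i _ => ?_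
  rw [Polynomial.sum]
  refine (coeffNorm_sum_le _ _).trans ?_
  simp only [coeffNorm_monomial, abs_mul]
  rw [coeffNorm, Polynomial.sum, Finset.mul_sum]

theorem coeffNorm_C_mul (c : ℝ) (p : ℝ[X]) : coeffNorm (C c * p) = |c| * coeffNorm p := by
  set n := max (C c * p).natDegree p.natDegree + 1
  rw [coeffNorm_eq_sum_range (n := n) (by omega), coeffNorm_eq_sum_range (p := p) (n := n) (by omega),
    Finset.mul_sum]
  simp [abs_mul]

theorem coeffNorm_derivative_le {p : ℝ[X]} {D : ℕ} (h : p.natDegree ≤ D) :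
    coeffNorm (derivative p) ≤ D * coeffNorm p := by
  rw [derivative_apply, Polynomial.sum]
  refine (coeffNorm_sum_le _ _).trans ?_
  rw [coeffNorm, Polynomial.sum, Finset.mul_sum]
  refine Finset.sum_le_sum fun i hi => ?_
  rw [C_mul_X_pow_eq_monomial, coeffNorm_monomial, abs_mul, Nat.abs_cast, mul_comm]
  have : (i : ℝ) ≤ D := by exact_mod_cast (le_natDegree_of_mem_supp i hi).trans h
  gcongr

theorem abs_eval_le_coeffNorm (p : ℝ[X]) {x : ℝ} (hx : x ∈ Set.Icc (0 : ℝ) 1) :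
    |p.eval x| ≤ coeffNorm p := by
  rw [eval_eq_sum, Polynomial.sum, coeffNorm, Polynomial.sum]
  refine (Finset.abs_sum_le_sum_abs _ _).trans (Finset.sum_le_sum fun i _ => ?_)
  rw [abs_mul]
  refine mul_le_of_le_one_right (abs_nonneg _) ?_
  rw [abs_of_nonneg (pow_nonneg hx.1 _)]
  exact pow_le_one₀ hx.1 hx.2

theorem coeffNorm_iterate_derivative_le {D : ℕ} (k : ℕ) {p : ℝ[X]} (h : p.natDegree ≤ D) :
    coeffNorm (derivative^[k] p) ≤ (D : ℝ) ^ k * coeffNorm p := by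
  induction k with
  | zero => simp
  | succ k ih =>
    rw [Function.iterate_succ_apply']
    refine (coeffNorm_derivative_le
      ((natDegree_iterate_derivative p k).trans ((Nat.sub_le _ _).trans h))).trans ?_
    rw [pow_succ', mul_assoc]
    gcongr

/-- Integration over the unit interval. -/
noncomputable def unitIntegral : ℝ[X] →ₗ[ℝ] ℝ where
  toFun p := ∫ x in (0 : ℝ)..1, p.eval x
  map_add' p q := by
    simp only [eval_add]
    exact intervalIntegral.integral_add (p.continuous.intervalIntegrable _ _)
      (q.continuous.intervalIntegrable _ _)
  map_smul' c p := by simp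

theorem unitIntegral_apply (p : ℝ[X]) : unitIntegral p = ∫ x in (0 : ℝ)..1, p.eval x := rfl

theorem unitIntegral_derivative (p : ℝ[X]) :
    unitIntegral (derivative p) = p.eval 1 - p.eval 0 :=
  intervalIntegral.integral_eq_sub_of_hasDerivAt (fun x _ => p.hasDerivAt x)
    ((derivative p).continuous.intervalIntegrable _ _)

theorem abs_unitIntegral_le (p : ℝ[X]) : |unitIntegral p| ≤ coeffNorm p := by
  have := intervalIntegral.norm_integral_le_of_norm_le_const (a := 0) (b := 1)
    (f := fun x => p.eval x) (C := coeffNorm p) (fun x hx => by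
      rw [Set.uIoc_of_le zero_le_one] at hx
      exact abs_eval_le_coeffNorm p ⟨hx.1.le, hx.2⟩)
  simpa [unitIntegral_apply] using this

theorem abs_unitIntegral_mul_le (p q : ℝ[X]) :
    |unitIntegral (p * q)| ≤ coeffNorm p * coeffNorm q :=
  (abs_unitIntegral_le _).trans (coeffNorm_mul_le p q)

/-- The polynomial `(x (1 - x))^n`. -/
noncomputable def bump (n : ℕ) : ℝ[X] := (X * (1 - X)) ^ n

theorem bump_eval_pos (n : ℕ) {x : ℝ} (hx : x ∈ Set.Ioo (0 : ℝ) 1) : 0 < (bump n).eval x := by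
  have h1 := hx.1
  have h2 : 0 < 1 - x := sub_pos.2 hx.2
  simp only [bump, eval_pow, eval_mul, eval_X, eval_sub, eval_one]
  positivity

/-- The integrand is nonnegative and p has finitely many roots, so it is positive at some interior
point. -/
theorem unitIntegral_bump_mul_sq_pos (n : ℕ) {p : ℝ[X]} (hp : p ≠ 0) :
    0 < unitIntegral (bump n * p ^ 2) := by
  have hnn : ∀ x ∈ Set.Ioc (0 : ℝ) 1, 0 ≤ (bump n * p ^ 2).eval x := by
    intro x hx
    have h1 := hx.1.le
    have h2 : 0 ≤ 1 - x := sub_nonneg.2 hx.2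
    simp only [bump, eval_pow, eval_mul, eval_X, eval_sub, eval_one]
    positivity
  have hfin : (p.roots.toFinset : Set ℝ).Finite := Finset.finite_toSet _
  obtain ⟨c, hc, hcr⟩ := ((Set.Ioo_infinite (zero_lt_one (α := ℝ))).sdiff hfin).nonempty
  refine intervalIntegral.integral_pos zero_lt_one (by fun_prop) hnn ⟨c, ⟨hc.1.le, hc.2.le⟩, ?_⟩
  have h0 : p.eval c ≠ 0 := fun h => hcr (by simp [hp, h])
  have := bump_eval_pos n hc
  rw [eval_mul, eval_pow]
  positivity

/-- A positive definite quadratic form on the finite-dimensional space of polynomials of degree at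
most d has a positive minimum on the unit sphere of coefficient vectors. The sphere is that of the
sup norm, which costs the factor (d + 1)^2. -/
theorem exists_le_unitIntegral_bump_mul_sq (n d : ℕ) :
    ∃ c : ℝ, 0 < c ∧ ∀ p : ℝ[X], p.natDegree ≤ d →
      c * coeffNorm p ^ 2 ≤ unitIntegral (bump n * p ^ 2) := by
  let poly : (Fin (d + 1) → ℝ) → ℝ[X] := fun v => ∑ i, C (v i) * X ^ (i : ℕ)
  let Φ : (Fin (d + 1) → ℝ) → ℝ := fun v => unitIntegral (bump n * poly v ^ 2)
  have hΦ : Continuous Φ := by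
    have : Φ = fun v => ∑ i : Fin (d + 1), ∑ j : Fin (d + 1), v i * v j *
        unitIntegral (bump n * X ^ (i : ℕ) * X ^ (j : ℕ)) := by
      funext v
      have e : bump n * poly v ^ 2 =
          ∑ i : Fin (d + 1), ∑ j : Fin (d + 1), (v i * v j) • (bump n * X ^ (i : ℕ) * X ^ (j : ℕ)) := by
        rw [sq, Finset.sum_mul_sum, Finset.mul_sum]
        simp only [Finset.mul_sum, smul_eq_C_mul, C_mul]
        refine Finset.sum_congr rfl fun i _ => Finset.sum_congr rfl fun j _ => ?_
        ring
      simp only [Φ, e, map_sum, map_smul, smul_eq_mul]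
    rw [this]
    fun_prop
  let S : Set (Fin (d + 1) → ℝ) := Metric.sphere 0 1
  have hcoeff : ∀ v (i : Fin (d + 1)), (poly v).coeff i = v i := by
    intro v i
    simp only [poly, finsetSum_coeff, coeff_C_mul, coeff_X_pow]
    simp [Fin.val_inj]
  have hpos : ∀ v ∈ S, 0 < Φ v := by
    intro v hv
    refine unitIntegral_bump_mul_sq_pos n fun h0 => ?_
    have : v = 0 := by
      funext i
      rw [← hcoeff v i, h0, coeff_zero]
      rfl
    simp [S, this] at hv
  obtain ⟨v₀, hv₀, hmin⟩ := (isCompact_sphere (0 : Fin (d + 1) → ℝ) 1).exists_isMinOn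
    (NormedSpace.sphere_nonempty.2 zero_le_one) hΦ.continuousOn
  refine ⟨Φ v₀ / (d + 1 : ℝ) ^ 2, div_pos (hpos v₀ hv₀) (by positivity), fun p hp => ?_⟩
  set v : Fin (d + 1) → ℝ := fun i => p.coeff i with hv
  have hpv : poly v = p := by
    simp only [poly, hv]
    rw [Fin.sum_univ_eq_sum_range (fun i => C (p.coeff i) * X ^ i)]
    exact (p.as_sum_range_C_mul_X_pow' (Nat.lt_succ_of_le hp)).symm
  have hnorm : coeffNorm p ≤ (d + 1) * ‖v‖ := by
    rw [coeffNorm_eq_sum_range (Nat.lt_succ_of_le hp),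
      ← Fin.sum_univ_eq_sum_range (fun i => |p.coeff i|)]
    refine (Finset.sum_le_card_nsmul _ _ ‖v‖ fun i _ => norm_le_pi_norm v i).trans ?_
    simp
  rcases eq_or_ne v 0 with h0 | h0
  · have : p = 0 := by rw [← hpv, h0]; simp [poly]
    simp [this, coeffNorm_zero]
  have hv0 : 0 < ‖v‖ := norm_pos_iff.2 h0
  have hmem : ‖v‖⁻¹ • v ∈ S := by simp [S, norm_smul, hv0.ne']
  have h1 : Φ v₀ ≤ Φ (‖v‖⁻¹ • v) := hmin hmem
  have h2 : Φ (‖v‖⁻¹ • v) = (‖v‖⁻¹) ^ 2 * unitIntegral (bump n * p ^ 2) := by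
    have : poly (‖v‖⁻¹ • v) = C ‖v‖⁻¹ * p := by
      rw [← hpv]
      simp [poly, Finset.mul_sum, mul_assoc]
    simp only [Φ, this]
    rw [mul_pow, ← C_pow, mul_left_comm, ← smul_eq_C_mul, map_smul, smul_eq_mul]
  rw [h2, inv_pow, inv_mul_eq_div, le_div_iff₀ (by positivity)] at h1
  have h3 : coeffNorm p ^ 2 ≤ ((d + 1) * ‖v‖) ^ 2 := by
    have := coeffNorm_nonneg p
    gcongr
  have h4 := (hpos v₀ hv₀).le
  calc Φ v₀ / (d + 1 : ℝ) ^ 2 * coeffNorm p ^ 2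
      ≤ Φ v₀ / (d + 1 : ℝ) ^ 2 * ((d + 1) * ‖v‖) ^ 2 := by gcongr
    _ = Φ v₀ * ‖v‖ ^ 2 := by field_simp
    _ ≤ _ := h1

end CoefficientNorm

/-! ### Polynomials with prescribed end jets and prescribed area. -/

section GapPolynomials

open Polynomial

/-- The area form `∫ (p' q - q' p)` over the unit interval. -/
noncomputable def areaForm (p q : ℝ[X]) : ℝ :=
  unitIntegral (derivative p * q - derivative q * p)

theorem areaForm_swap (p q : ℝ[X]) : areaForm q p = -areaForm p q := by
  rw [areaForm, areaForm, ← map_neg, neg_sub]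

theorem areaForm_add_right (p q v : ℝ[X]) :
    areaForm p (q + v) = areaForm p q + areaForm p v := by
  rw [areaForm, areaForm, areaForm, ← map_add unitIntegral, derivative_add]
  congr 1
  ring

theorem areaForm_add_left (p u q : ℝ[X]) :
    areaForm (p + u) q = areaForm p q + areaForm u q := by
  rw [areaForm, areaForm, areaForm, ← map_add unitIntegral, derivative_add]
  congr 1
  ring

/-- Integration by parts moves the derivative onto p. If q vanishes at both ends the area is 2 ∫ p'
q, bounded by ‖p'‖ and ‖q‖ alone. -/
theorem areaForm_eq (p q : ℝ[X]) :
    areaForm p q = 2 * unitIntegral (derivative p * q) -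
      (p.eval 1 * q.eval 1 - p.eval 0 * q.eval 0) := by
  have h := unitIntegral_derivative (p * q)
  rw [derivative_mul, map_add] at h
  rw [areaForm, map_sub, mul_comm (derivative q)]
  simp only [eval_mul] at h
  linarith

/-- Flatness at an end point is encoded as divisibility, which is stable under multiplication. -/
theorem dvd_iterate_derivative_eval_eq_zero {p : ℝ[X]} {a : ℝ} {m k : ℕ}
    (h : (X - C a) ^ (m + 1) ∣ p) (hk : k ≤ m) : (derivative^[k] p).eval a = 0 := by
  have h1 := pow_sub_dvd_iterate_derivative_of_pow_dvd k h
  have h2 : X - C a ∣ derivative^[k] p := (dvd_pow_self _ (by omega)).trans h1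
  exact dvd_iff_isRoot.1 h2

theorem X_pow_dvd_bump (n : ℕ) : (X - C 0) ^ n ∣ bump n := by
  rw [C_0, sub_zero, bump, mul_pow]
  exact dvd_mul_right _ _

theorem X_sub_one_pow_dvd_bump (n : ℕ) : (X - C 1) ^ n ∣ bump n := by
  rw [bump]
  exact pow_dvd_pow_of_dvd ⟨-X, by rw [C_1]; ring⟩ n

theorem bump_ne_zero (n : ℕ) : bump n ≠ 0 := by
  intro h
  have := bump_eval_pos n (x := 1 / 2) ⟨by norm_num, by norm_num⟩
  simp [h] at this

theorem bump_eval_zero (n : ℕ) : (bump (n + 1)).eval 0 = 0 := by simp [bump]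

theorem bump_eval_one (n : ℕ) : (bump (n + 1)).eval 1 = 0 := by simp [bump]

theorem derivative_bump_ne_zero (n : ℕ) : derivative (bump (n + 1)) ≠ 0 := by
  intro h
  have h0 := bump_eval_zero n
  rw [eq_C_of_derivative_eq_zero h] at h0
  have := bump_ne_zero (n + 1)
  rw [eq_C_of_derivative_eq_zero h] at this
  simp only [eval_C] at h0
  simp [h0] at this

-- Adding λ η p' to q, η = `bump (n + 1)`, keeps the jets of order at most n at both ends and adds 2
-- λ ∫ η p'^2 to the area. This integral is at least c ‖p'‖^2, so an error O(W ‖p'‖) is repaired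
-- with ‖λ η p'‖ = O(W). The error has that form once ‖p'‖ is not small against W, which is arranged
-- by adding to p a multiple of η of size O(W).
set_option maxHeartbeats 2000000 in
theorem exists_area_correction_of_le (n D : ℕ) {B : ℝ} (hB : 0 ≤ B) :
    ∃ C' : ℝ, 0 ≤ C' ∧ ∃ D' : ℕ, ∀ (W : ℝ), 0 < W → ∀ p q : ℝ[X], p.natDegree ≤ D →
      coeffNorm (derivative q) ≤ coeffNorm (derivative p) → ∀ A : ℝ,
      |A - areaForm p q| ≤ B * (W * (W + coeffNorm (derivative p))) →
      ∃ u v : ℝ[X], bump (n + 1) ∣ u ∧ bump (n + 1) ∣ v ∧ coeffNorm u ≤ C' * W ∧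
        coeffNorm v ≤ C' * W ∧ u.natDegree ≤ D' ∧ v.natDegree ≤ D' ∧
        areaForm (p + u) (q + v) = A := by
  set η := bump (n + 1) with hη
  set d := η.natDegree with hd
  obtain ⟨c, hc, hcp⟩ := exists_le_unitIntegral_bump_mul_sq (n + 1) (D + d)
  have hη' : 0 < coeffNorm (derivative η) := coeffNorm_pos (derivative_bump_ne_zero n)
  have hη0 := coeffNorm_nonneg η
  -- With this factor (S W η)' has norm 2 W, enough to dominate ‖p'‖ when the latter is less than W.
  set S : ℝ := 2 / coeffNorm (derivative η) with hS
  have hS0 : 0 < S := by positivity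
  -- The first term is the given bound with W + N ≤ 2 N₂; the second is the area change 2 ∫ q' u
  -- caused by u, where ‖q'‖ ≤ N ≤ 2 N₂.
  set K : ℝ := 2 * B + 4 * (S * coeffNorm η) with hK
  have hK0 : 0 ≤ K := by positivity
  clear_value S K d η
  refine ⟨S * coeffNorm η + K / c * coeffNorm η, by positivity, d + (D + d),
    fun W hW p q hp hpq A hA => ?_⟩
  set N := coeffNorm (derivative p) with hN
  have hN0 : 0 ≤ N := coeffNorm_nonneg _
  -- make the derivative of the first component large
  obtain ⟨u, hu1, hu2, hu3, hu4⟩ : ∃ u : ℝ[X], η ∣ u ∧ coeffNorm u ≤ S * coeffNorm η * W ∧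
      u.natDegree ≤ d ∧ W + N ≤ 2 * coeffNorm (derivative (p + u)) := by
    rcases le_or_gt W N with h | h
    · refine ⟨0, dvd_zero _, by rw [coeffNorm_zero]; positivity, by simp, ?_⟩
      rw [add_zero]
      linarith
    · refine ⟨C (S * W) * η, dvd_mul_left _ _, ?_, (natDegree_C_mul_le _ _).trans hd.ge, ?_⟩
      · rw [coeffNorm_C_mul, abs_of_nonneg (by positivity)]
        apply le_of_eq
        ring
      · have h1 := coeffNorm_add_le (derivative (p + C (S * W) * η)) (C (-1) * derivative p)
        have h2 : derivative (p + C (S * W) * η) + C (-1) * derivative p =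
            C (S * W) * derivative η := by
          rw [derivative_add, derivative_C_mul, C_neg, C_1]
          ring
        rw [h2, coeffNorm_C_mul, coeffNorm_C_mul, abs_of_nonneg (by positivity), abs_neg, abs_one,
          one_mul, ← hN] at h1
        have h3 : S * W * coeffNorm (derivative η) = 2 * W := by
          rw [hS]
          field_simp
        linarith
  set p₂ := p + u with hp₂
  set N₂ := coeffNorm (derivative p₂) with hN₂
  have hN₂0 : 0 < N₂ := by linarith
  have hp₂d : p₂.natDegree ≤ D + d :=
    (natDegree_add_le _ _).trans (max_le (by omega) (by omega))
  have hp₂d' : (derivative p₂).natDegree ≤ D + d :=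
    (natDegree_derivative_le _).trans (by omega)
  have hu0 : u.eval 0 = 0 := by
    obtain ⟨w, rfl⟩ := hu1
    rw [eval_mul, hη, bump_eval_zero, zero_mul]
  have hu1' : u.eval 1 = 0 := by
    obtain ⟨w, rfl⟩ := hu1
    rw [eval_mul, hη, bump_eval_one, zero_mul]
  set E := A - areaForm p₂ q with hE
  have hEb : |E| ≤ K * (W * N₂) := by
    have h1 : E = (A - areaForm p q) + 2 * unitIntegral (derivative q * u) := by
      have := areaForm_eq q u
      rw [hu0, hu1', areaForm_swap] at this
      rw [hE, hp₂, areaForm_add_left]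
      linarith
    have h2 : |unitIntegral (derivative q * u)| ≤ N * (S * coeffNorm η * W) :=
      (abs_unitIntegral_mul_le _ _).trans (by gcongr; exact coeffNorm_nonneg _)
    rw [h1]
    refine (abs_add_le _ _).trans ?_
    rw [abs_mul, abs_two]
    have h3 : B * (W * (W + N)) ≤ B * (W * (2 * N₂)) := by gcongr
    have h4 : N * (S * coeffNorm η * W) ≤ (2 * N₂) * (S * coeffNorm η * W) := by
      gcongr
      linarith
    rw [hK]
    linarith
  set e := unitIntegral (η * derivative p₂ ^ 2) with he
  have hcN : c * N₂ ^ 2 ≤ e := by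
    have := hcp _ hp₂d'
    rwa [← hη, ← hN₂, ← he] at this
  have he0 : 0 < e := lt_of_lt_of_le (by positivity) hcN
  set lam := E / (2 * e) with hlam
  have hlamb : |lam| * N₂ ≤ K / c * W := by
    rw [hlam, abs_div, abs_of_pos (by positivity : 0 < 2 * e), div_mul_eq_mul_div,
      div_le_iff₀ (by positivity)]
    calc |E| * N₂ ≤ K * (W * N₂) * N₂ := by gcongr
      _ = K / c * W * (c * N₂ ^ 2) := by field_simp
      _ ≤ K / c * W * (2 * e) :=
        mul_le_mul_of_nonneg_left (by linarith) (by positivity)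
  refine ⟨u, C lam * (η * derivative p₂), hu1, ⟨C lam * derivative p₂, by ring⟩, ?_, ?_, ?_, ?_, ?_⟩
  · refine hu2.trans ?_
    gcongr
    have : 0 ≤ K / c * coeffNorm η := by positivity
    linarith
  · rw [coeffNorm_C_mul]
    calc |lam| * coeffNorm (η * derivative p₂) ≤ |lam| * (coeffNorm η * N₂) := by
          gcongr
          exact coeffNorm_mul_le _ _
      _ = coeffNorm η * (|lam| * N₂) := by ring
      _ ≤ coeffNorm η * (K / c * W) := by gcongr
      _ ≤ _ := by
        have : 0 ≤ S * coeffNorm η * W := by positivity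
        nlinarith
  · omega
  · refine (natDegree_C_mul_le _ _).trans (natDegree_mul_le.trans ?_)
    omega
  · rw [areaForm_add_right, areaForm_eq p₂ (C lam * _)]
    have h1 : derivative p₂ * (C lam * (η * derivative p₂)) =
        lam • (η * derivative p₂ ^ 2) := by
      rw [smul_eq_C_mul]
      ring
    rw [h1, map_smul, ← he]
    simp only [eval_mul, hη, bump_eval_zero, bump_eval_one, smul_eq_mul]
    have : 2 * (lam * e) = E := by
      rw [hlam]
      field_simp
    linarith

/-- The area form is antisymmetric, so the component with the larger derivative may be taken as the
first. -/
theorem exists_area_correction (n D : ℕ) {B : ℝ} (hB : 0 ≤ B) :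
    ∃ C' : ℝ, 0 ≤ C' ∧ ∃ D' : ℕ, ∀ (W : ℝ), 0 < W → ∀ p q : ℝ[X], p.natDegree ≤ D →
      q.natDegree ≤ D → ∀ A : ℝ,
      |A - areaForm p q| ≤
        B * (W * (W + (coeffNorm (derivative p) + coeffNorm (derivative q)))) →
      ∃ u v : ℝ[X], bump (n + 1) ∣ u ∧ bump (n + 1) ∣ v ∧ coeffNorm u ≤ C' * W ∧
        coeffNorm v ≤ C' * W ∧ u.natDegree ≤ D' ∧ v.natDegree ≤ D' ∧
        areaForm (p + u) (q + v) = A := by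
  obtain ⟨C', hC', D', h⟩ := exists_area_correction_of_le n D (by positivity : 0 ≤ 2 * B)
  refine ⟨C', hC', D', fun W hW p q hp hq A hA => ?_⟩
  rcases le_total (coeffNorm (derivative q)) (coeffNorm (derivative p)) with hpq | hpq
  · refine h W hW p q hp hpq A (hA.trans ?_)
    have h1 : W * (W + (coeffNorm (derivative p) + coeffNorm (derivative q))) ≤
        2 * (W * (W + coeffNorm (derivative p))) := by nlinarith
    linarith [mul_le_mul_of_nonneg_left h1 hB]
  · have hA' : |-A - areaForm q p| ≤ 2 * B * (W * (W + coeffNorm (derivative q))) := by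
      rw [areaForm_swap p q, ← abs_neg, show -(-A - -areaForm p q) = A - areaForm p q by ring]
      refine hA.trans ?_
      have h1 : W * (W + (coeffNorm (derivative p) + coeffNorm (derivative q))) ≤
          2 * (W * (W + coeffNorm (derivative q))) := by nlinarith
      linarith [mul_le_mul_of_nonneg_left h1 hB]
    obtain ⟨u, v, h1, h2, h3, h4, h5, h6, h7⟩ := h W hW q p hq hpq (-A) hA'
    refine ⟨v, u, h2, h1, h4, h3, h6, h5, ?_⟩
    rw [areaForm_swap, h7, neg_neg]

/-- A polynomial which is flat of order `m` at `0` and equal to `1` to order `m` at `1`. -/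
theorem exists_step_polynomial (m : ℕ) :
    ∃ p : ℝ[X], (X - C 0) ^ (m + 1) ∣ p ∧ (X - C 1) ^ (m + 1) ∣ p - 1 := by
  -- Bézout: in a X^(m+1) + b (X - 1)^(m+1) = 1 the first summand is the desired step.
  have h : IsCoprime ((X - C (0 : ℝ)) ^ (m + 1)) ((X - C (1 : ℝ)) ^ (m + 1)) :=
    (isCoprime_X_sub_C_of_isUnit_sub (by simp)).pow
  obtain ⟨a, b, hab⟩ := h
  exact ⟨a * (X - C 0) ^ (m + 1), dvd_mul_left _ _, ⟨-b, by rw [← hab]; ring⟩⟩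

set_option maxHeartbeats 2000000 in
/-- Polynomials on the unit interval with prescribed jets at the ends and prescribed area. -/
theorem exists_gap_polynomials (m : ℕ) {C₀ : ℝ} (hC₀ : 0 ≤ C₀) :
    ∃ C₁ : ℝ, 0 ≤ C₁ ∧ ∀ (W : ℝ), 0 < W → ∀ P Q : ℝ[X], P.natDegree ≤ m → Q.natDegree ≤ m →
      ∀ r s : ℕ → ℝ, (∀ k ≤ m, |r k| ≤ C₀ * W) → (∀ k ≤ m, |s k| ≤ C₀ * W) → ∀ A : ℝ,
      |A - areaForm P Q - r 0 * Q.eval 0 + s 0 * P.eval 0| ≤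
        C₀ * (W * (W + (coeffNorm (derivative P) + coeffNorm (derivative Q)))) →
      ∃ p q : ℝ[X],
        (∀ k ≤ m, (derivative^[k] p).eval 0 = (derivative^[k] P).eval 0) ∧
        (∀ k ≤ m, (derivative^[k] q).eval 0 = (derivative^[k] Q).eval 0) ∧
        (∀ k ≤ m, (derivative^[k] p).eval 1 = (derivative^[k] P).eval 1 + r k) ∧
        (∀ k ≤ m, (derivative^[k] q).eval 1 = (derivative^[k] Q).eval 1 + s k) ∧
        (∀ x ∈ Set.Icc (0 : ℝ) 1, |(derivative^[m + 1] p).eval x| ≤ C₁ * W) ∧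
        (∀ x ∈ Set.Icc (0 : ℝ) 1, |(derivative^[m + 1] q).eval x| ≤ C₁ * W) ∧
        areaForm p q = A := by
  obtain ⟨χ, hχ0, hχ1⟩ := exists_step_polynomial m
  set M : ℝ := ∑ k ∈ Finset.range (m + 1), coeffNorm ((X - C (1 : ℝ)) ^ k) with hM
  have hM0 : 0 ≤ M := Finset.sum_nonneg fun _ _ => coeffNorm_nonneg _
  set d := χ.natDegree + m with hd
  have hχn := coeffNorm_nonneg χ
  set B : ℝ := coeffNorm χ * (M * C₀) with hB
  have hB0 : 0 ≤ B := by positivity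
  -- After interpolation the area error is at most C₀ W^2 + 2 d B^2 W^2 + (2 C₀ + 2 B) W (‖P'‖ +
  -- ‖Q'‖), and passing from P', Q' to (P + u)', (Q + v)' costs 2 d B W inside the last bracket.
  set K : ℝ := (2 * C₀ + 2 * B) * (1 + 2 * d * B) + 2 * d * B ^ 2 + C₀ with hK
  have hK0 : 0 ≤ K := by positivity
  obtain ⟨C', hC', D', hcor⟩ := exists_area_correction m d hK0
  clear_value M d B K
  refine ⟨((d + D' : ℕ) : ℝ) ^ (m + 1) * (B + C'), by positivity,
    fun W hW P Q hP hQ r s hr hs A hA => ?_⟩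
  -- interpolating perturbation
  have hstep : ∀ r : ℕ → ℝ, (∀ k ≤ m, |r k| ≤ C₀ * W) → ∃ u : ℝ[X],
      (X - C 0) ^ (m + 1) ∣ u ∧ (∀ k ≤ m, (derivative^[k] u).eval 1 = r k) ∧
      coeffNorm u ≤ B * W ∧ u.natDegree ≤ d := by
    intro r hr
    set R : ℝ[X] := taylorPoly m (fun k _ => r k) 1 with hR
    have hRd : R.natDegree ≤ m := natDegree_taylorPoly_le _ _ _
    have hRn : coeffNorm R ≤ M * (C₀ * W) := by
      rw [hR, taylorPoly, hM, Finset.sum_mul]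
      refine (coeffNorm_sum_le _ _).trans (Finset.sum_le_sum fun k hk => ?_)
      have hkm : k ≤ m := Nat.lt_succ_iff.1 (Finset.mem_range.1 hk)
      rw [coeffNorm_C_mul, mul_comm]
      have h1 : |r k / (k ! : ℝ)| ≤ |r k| := by
        rw [abs_div, Nat.abs_cast]
        exact div_le_self (abs_nonneg _) (by exact_mod_cast Nat.factorial_pos k)
      have := coeffNorm_nonneg ((X - C (1 : ℝ)) ^ k)
      have := h1.trans (hr k hkm)
      gcongr
    refine ⟨χ * R, hχ0.mul_right _, fun k hk => ?_, ?_, ?_⟩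
    · have h1 : χ * R = (χ - 1) * R + R := by ring
      rw [h1, iterate_map_add, eval_add,
        dvd_iterate_derivative_eval_eq_zero (hχ1.mul_right R) hk, zero_add, hR,
        iterate_derivative_taylorPoly _ _ hk, taylorPoly_eval_self, add_zero]
    · refine (coeffNorm_mul_le _ _).trans ?_
      rw [hB, mul_assoc, mul_assoc]
      gcongr
    · exact natDegree_mul_le.trans (by omega)
  obtain ⟨u, hu0, hu1, hun, hud⟩ := hstep r hr
  obtain ⟨v, hv0, hv1, hvn, hvd⟩ := hstep s hs
  have hun0 := coeffNorm_nonneg u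
  have hvn0 := coeffNorm_nonneg v
  have hud' := coeffNorm_derivative_le hud
  have hvd' := coeffNorm_derivative_le hvd
  set nP := coeffNorm (derivative P) with hnP
  set nQ := coeffNorm (derivative Q) with hnQ
  have hnP0 : 0 ≤ nP := coeffNorm_nonneg _
  have hnQ0 : 0 ≤ nQ := coeffNorm_nonneg _
  have hud'' : coeffNorm (derivative u) ≤ d * (B * W) := hud'.trans (by gcongr)
  have hvd'' : coeffNorm (derivative v) ≤ d * (B * W) := hvd'.trans (by gcongr)
  clear_value nP nQ
  have hsub : ∀ p u : ℝ[X], coeffNorm (derivative p) ≤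
      coeffNorm (derivative (p + u)) + coeffNorm (derivative u) := by
    intro p u
    have h1 := coeffNorm_add_le (derivative (p + u)) (C (-1) * derivative u)
    rw [coeffNorm_C_mul, abs_neg, abs_one, one_mul] at h1
    convert h1 using 2
    rw [derivative_add, C_neg, C_1]
    ring
  have hE : |A - areaForm (P + u) (Q + v)| ≤
      K * (W * (W + (coeffNorm (derivative (P + u)) + coeffNorm (derivative (Q + v))))) := by
    have hu00 : u.eval 0 = 0 := dvd_iterate_derivative_eval_eq_zero (k := 0) hu0 (Nat.zero_le m)
    have hv00 : v.eval 0 = 0 := dvd_iterate_derivative_eval_eq_zero (k := 0) hv0 (Nat.zero_le m)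
    have hu10 : u.eval 1 = r 0 := hu1 0 (Nat.zero_le m)
    have hv10 : v.eval 1 = s 0 := hv1 0 (Nat.zero_le m)
    -- The boundary term r₀ Q(1) is split as r₀ Q(0), present in the hypothesis on A, plus r₀ (Q(1)
    -- - Q(0)), which only involves Q'; likewise for s₀ and P.
    have e1 : A - areaForm (P + u) (Q + v) =
        (A - areaForm P Q - r 0 * Q.eval 0 + s 0 * P.eval 0)
        - r 0 * (Q.eval 1 - Q.eval 0) + s 0 * (P.eval 1 - P.eval 0)
        - 2 * unitIntegral (derivative P * v) + 2 * unitIntegral (derivative Q * u)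
        - unitIntegral (derivative u * v) + unitIntegral (derivative v * u) := by
      have h1 := areaForm_eq P v
      have h2 := areaForm_eq Q u
      have h3 : areaForm u v =
        unitIntegral (derivative u * v) - unitIntegral (derivative v * u) := map_sub _ _ _
      rw [hv00, hv10] at h1
      rw [hu00, hu10, areaForm_swap] at h2
      rw [areaForm_add_left, areaForm_add_right, areaForm_add_right, h1, h3]
      linarith
    have b1 : |r 0 * (Q.eval 1 - Q.eval 0)| ≤ C₀ * W * nQ := by
      rw [abs_mul, ← unitIntegral_derivative]
      exact mul_le_mul (hr 0 (Nat.zero_le m)) ((abs_unitIntegral_le _).trans hnQ.ge)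
        (abs_nonneg _) (by positivity)
    have b2 : |s 0 * (P.eval 1 - P.eval 0)| ≤ C₀ * W * nP := by
      rw [abs_mul, ← unitIntegral_derivative]
      exact mul_le_mul (hs 0 (Nat.zero_le m)) ((abs_unitIntegral_le _).trans hnP.ge)
        (abs_nonneg _) (by positivity)
    have b3 : |unitIntegral (derivative P * v)| ≤ nP * (B * W) :=
      (abs_unitIntegral_mul_le _ _).trans (by gcongr; exact hnP.ge)
    have b4 : |unitIntegral (derivative Q * u)| ≤ nQ * (B * W) :=
      (abs_unitIntegral_mul_le _ _).trans (by gcongr; exact hnQ.ge)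
    have b5 : |unitIntegral (derivative u * v)| ≤ d * (B * W) * (B * W) :=
      (abs_unitIntegral_mul_le _ _).trans (by gcongr)
    have b6 : |unitIntegral (derivative v * u)| ≤ d * (B * W) * (B * W) :=
      (abs_unitIntegral_mul_le _ _).trans (by gcongr)
    have b7 := (hsub P u).trans (add_le_add_right hud'' _)
    have b8 := (hsub Q v).trans (add_le_add_right hvd'' _)
    rw [← hnP] at b7
    rw [← hnQ] at b8
    set n₁ := coeffNorm (derivative (P + u)) + coeffNorm (derivative (Q + v)) with hn₁
    have hn₁0 : 0 ≤ n₁ := add_nonneg (coeffNorm_nonneg _) (coeffNorm_nonneg _)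
    have b9 : nP + nQ ≤ n₁ + 2 * d * B * W := by linarith
    have b10 : |A - areaForm (P + u) (Q + v)| ≤
        C₀ * (W * W) + 2 * d * B ^ 2 * (W * W) + (2 * C₀ + 2 * B) * W * (nP + nQ) := by
      rw [e1]
      rw [abs_le] at hA b1 b2 b3 b4 b5 b6 ⊢
      constructor <;> linarith
    have b11 : (2 * C₀ + 2 * B) * W * (nP + nQ) ≤
        (2 * C₀ + 2 * B) * W * (n₁ + 2 * d * B * W) := by gcongr
    have b12 : 0 ≤ W * n₁ := by positivity
    have b13 : 0 ≤ W * W := by positivity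
    have b14 : K * (W * (W + n₁)) - (C₀ * (W * W) + 2 * d * B ^ 2 * (W * W) +
        (2 * C₀ + 2 * B) * W * (n₁ + 2 * d * B * W)) =
        (2 * C₀ + 2 * B) * (W * W) + ((2 * C₀ + 2 * B) * (2 * d * B) + 2 * d * B ^ 2 + C₀) *
          (W * n₁) := by
      rw [hK]
      ring
    have b15 : 0 ≤ (2 * C₀ + 2 * B) * (W * W) +
        ((2 * C₀ + 2 * B) * (2 * d * B) + 2 * d * B ^ 2 + C₀) * (W * n₁) := by positivity
    linarith
  obtain ⟨u₂, v₂, hu₂, hv₂, hu₂n, hv₂n, hu₂d, hv₂d, harea⟩ := hcor W hW (P + u) (Q + v)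
    ((natDegree_add_le _ _).trans (max_le (by omega) hud))
    ((natDegree_add_le _ _).trans (max_le (by omega) hvd)) A hE
  have hjet0 : ∀ P u u₂ : ℝ[X], (X - C 0) ^ (m + 1) ∣ u → bump (m + 1) ∣ u₂ → ∀ k ≤ m,
      (derivative^[k] (P + u + u₂)).eval 0 = (derivative^[k] P).eval 0 := by
    intro P u u₂ hu hu₂ k hk
    rw [iterate_map_add, iterate_map_add, eval_add, eval_add,
      dvd_iterate_derivative_eval_eq_zero hu hk,
      dvd_iterate_derivative_eval_eq_zero ((X_pow_dvd_bump _).trans hu₂) hk, add_zero, add_zero]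
  have hjet1 : ∀ (P u u₂ : ℝ[X]) (r : ℕ → ℝ), (∀ k ≤ m, (derivative^[k] u).eval 1 = r k) →
      bump (m + 1) ∣ u₂ → ∀ k ≤ m,
      (derivative^[k] (P + u + u₂)).eval 1 = (derivative^[k] P).eval 1 + r k := by
    intro P u u₂ r hu hu₂ k hk
    rw [iterate_map_add, iterate_map_add, eval_add, eval_add, hu k hk,
      dvd_iterate_derivative_eval_eq_zero ((X_sub_one_pow_dvd_bump _).trans hu₂) hk, add_zero]
  have htop : ∀ P u u₂ : ℝ[X], P.natDegree ≤ m → coeffNorm u ≤ B * W → u.natDegree ≤ d →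
      coeffNorm u₂ ≤ C' * W → u₂.natDegree ≤ D' → ∀ x ∈ Set.Icc (0 : ℝ) 1,
      |(derivative^[m + 1] (P + u + u₂)).eval x| ≤
        ((d + D' : ℕ) : ℝ) ^ (m + 1) * (B + C') * W := by
    intro P u u₂ hP hu hud hu₂ hu₂d x hx
    -- P has degree at most m, so only the perturbations of size O(W) survive m + 1 derivatives.
    rw [add_assoc, iterate_map_add, iterate_derivative_eq_zero (by omega), zero_add]
    refine (abs_eval_le_coeffNorm _ hx).trans ((coeffNorm_iterate_derivative_le (D := d + D') _
      ((natDegree_add_le _ _).trans (max_le (by omega) (by omega)))).trans ?_)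
    rw [mul_assoc]
    gcongr
    refine (coeffNorm_add_le _ _).trans ?_
    linarith
  exact ⟨P + u + u₂, Q + v + v₂, hjet0 P u u₂ hu0 hu₂, hjet0 Q v v₂ hv0 hv₂,
    hjet1 P u u₂ r hu1 hu₂, hjet1 Q v v₂ s hv1 hv₂, htop P u u₂ hP hun hud hu₂n hu₂d,
    htop Q v v₂ hQ hvn hvd hv₂n hv₂d, harea⟩

end GapPolynomials

/-! ### Gluing functions along a closed set and its gaps. -/

section Gluing

/-- Closed subsets of the line which are unbounded in both directions. -/
structure IsTwoSided (E : Set ℝ) : Prop where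
  isClosed : IsClosed E
  exists_le : ∀ x, ∃ y ∈ E, y ≤ x
  exists_ge : ∀ x, ∃ y ∈ E, x ≤ y

/-- The bounded connected components `(a, b)` of the complement of `E`. -/
structure IsGap (E : Set ℝ) (a b : ℝ) : Prop where
  left_mem : a ∈ E
  right_mem : b ∈ E
  lt : a < b
  notMem : ∀ x ∈ Set.Ioo a b, x ∉ E

variable {E : Set ℝ}

/-- The last point of `E` before `x`. -/
noncomputable def leftPt (E : Set ℝ) (x : ℝ) : ℝ := sSup (E ∩ Set.Iic x)

/-- The first point of `E` after `x`. -/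
noncomputable def rightPt (E : Set ℝ) (x : ℝ) : ℝ := sInf (E ∩ Set.Ici x)

theorem IsTwoSided.leftPt_mem (hE : IsTwoSided E) (x : ℝ) : leftPt E x ∈ E ∩ Set.Iic x :=
  (hE.isClosed.inter isClosed_Iic).csSup_mem (hE.exists_le x) ⟨x, fun _ h => h.2⟩

theorem IsTwoSided.rightPt_mem (hE : IsTwoSided E) (x : ℝ) : rightPt E x ∈ E ∩ Set.Ici x :=
  (hE.isClosed.inter isClosed_Ici).csInf_mem (hE.exists_ge x) ⟨x, fun _ h => h.2⟩

theorem le_leftPt {x y : ℝ} (hy : y ∈ E) (h : y ≤ x) : y ≤ leftPt E x :=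
  le_csSup ⟨x, fun _ h => h.2⟩ ⟨hy, h⟩

theorem rightPt_le {x y : ℝ} (hy : y ∈ E) (h : x ≤ y) : rightPt E x ≤ y :=
  csInf_le ⟨x, fun _ h => h.2⟩ ⟨hy, h⟩

theorem IsTwoSided.leftPt_lt (hE : IsTwoSided E) {x : ℝ} (hx : x ∉ E) : leftPt E x < x :=
  lt_of_le_of_ne (hE.leftPt_mem x).2 fun h => hx (h ▸ (hE.leftPt_mem x).1)

theorem IsTwoSided.lt_rightPt (hE : IsTwoSided E) {x : ℝ} (hx : x ∉ E) : x < rightPt E x :=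
  lt_of_le_of_ne (hE.rightPt_mem x).2 fun h => hx (h ▸ (hE.rightPt_mem x).1)

theorem IsTwoSided.isGap (hE : IsTwoSided E) {x : ℝ} (hx : x ∉ E) :
    IsGap E (leftPt E x) (rightPt E x) where
  left_mem := (hE.leftPt_mem x).1
  right_mem := (hE.rightPt_mem x).1
  lt := (hE.leftPt_lt hx).trans (hE.lt_rightPt hx)
  notMem y hy hyE := by
    rcases le_total y x with h | h
    · exact (le_leftPt hyE h).not_gt hy.1
    · exact (rightPt_le hyE h).not_gt hy.2

theorem IsGap.leftPt_eq {a b x : ℝ} (h : IsGap E a b) (hE : IsTwoSided E) (hx : x ∈ Set.Ioo a b) :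
    leftPt E x = a := by
  refine le_antisymm ?_ (le_leftPt h.left_mem hx.1.le)
  by_contra! hlt
  have := hE.leftPt_mem x
  exact h.notMem _ ⟨hlt, lt_of_le_of_lt this.2 hx.2⟩ this.1

theorem IsGap.rightPt_eq {a b x : ℝ} (h : IsGap E a b) (hE : IsTwoSided E)
    (hx : x ∈ Set.Ioo a b) : rightPt E x = b := by
  refine le_antisymm (rightPt_le h.right_mem hx.2.le) ?_
  by_contra! hlt
  have := hE.rightPt_mem x
  exact h.notMem _ ⟨lt_of_lt_of_le hx.1 this.2, hlt⟩ this.1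

open Classical in
/-- The function which is `v` on `E` and `p a b` on every gap `(a, b)` of `E`. -/
noncomputable def glue (E : Set ℝ) (v : ℝ → ℝ) (p : ℝ → ℝ → ℝ → ℝ) (x : ℝ) : ℝ :=
  if x ∈ E then v x else p (leftPt E x) (rightPt E x) x

theorem glue_of_mem {v : ℝ → ℝ} {p : ℝ → ℝ → ℝ → ℝ} {x : ℝ} (hx : x ∈ E) :
    glue E v p x = v x := if_pos hx

theorem IsGap.glue_eq {a b : ℝ} (h : IsGap E a b) (hE : IsTwoSided E) {v : ℝ → ℝ}
    {p : ℝ → ℝ → ℝ → ℝ} (ha : p a b a = v a) (hb : p a b b = v b) {x : ℝ}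
    (hx : x ∈ Set.Icc a b) : glue E v p x = p a b x := by
  rcases hx.1.eq_or_lt with rfl | h1
  · rw [glue_of_mem h.left_mem, ha]
  rcases hx.2.eq_or_lt with rfl | h2
  · rw [glue_of_mem h.right_mem, hb]
  rw [glue, if_neg (h.notMem x ⟨h1, h2⟩), h.leftPt_eq hE ⟨h1, h2⟩, h.rightPt_eq hE ⟨h1, h2⟩]

theorem abs_increment_sub_le {u v : ℝ → ℝ} {a b c ε : ℝ} (hab : a ≤ b)
    (hv : ContinuousOn v (Set.Icc a b)) (hd : ∀ x ∈ Set.Ioo a b, HasDerivAt v (u x) x)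
    (hu : ∀ x ∈ Set.Ioo a b, |u x - c| ≤ ε) : |v b - v a - c * (b - a)| ≤ ε * (b - a) := by
  rcases hab.eq_or_lt with rfl | hab
  · simp
  obtain ⟨x, hx, h⟩ := exists_hasDerivAt_eq_slope v u hab hv hd
  have h0 : 0 < b - a := sub_pos.2 hab
  have h1 : v b - v a = u x * (b - a) := by
    rw [h]
    field_simp
  rw [h1, ← sub_mul, abs_mul, abs_of_pos h0]
  have := hu x hx
  gcongr

/-- For x in E and y in a gap, let e be the end of that gap lying between x and y. Differentiability
along E controls the step from x to e, and the mean value theorem with u close to u(x) controls the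
step from e to y. The errors ε |e - x| and ε |y - e| add up to ε |y - x|. -/
theorem hasDerivAt_of_gaps (hE : IsTwoSided E) {u v : ℝ → ℝ} (hu : Continuous u)
    (hgap : ∀ a b, IsGap E a b →
      ContinuousOn v (Set.Icc a b) ∧ ∀ x ∈ Set.Ioo a b, HasDerivAt v (u x) x)
    (hvE : ∀ x ∈ E, HasDerivWithinAt v (u x) E x) (x : ℝ) : HasDerivAt v (u x) x := by
  by_cases hx : x ∈ E
  swap
  · exact (hgap _ _ (hE.isGap hx)).2 x ⟨hE.leftPt_lt hx, hE.lt_rightPt hx⟩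
  rw [hasDerivAt_iff_isLittleO, Asymptotics.isLittleO_iff]
  intro ε hε
  have h1 := hvE x hx
  rw [hasDerivWithinAt_iff_isLittleO, Asymptotics.isLittleO_iff] at h1
  obtain ⟨δ₁, hδ₁, h1⟩ := Metric.mem_nhdsWithin_iff.1 (h1 hε)
  obtain ⟨δ₂, hδ₂, h2⟩ := Metric.continuous_iff.1 hu x ε hε
  refine Metric.eventually_nhds_iff.2 ⟨min δ₁ δ₂, lt_min hδ₁ hδ₂, fun y hy => ?_⟩
  have hy1 := hy.trans_le (min_le_left _ _)
  have hy2 := hy.trans_le (min_le_right _ _)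
  have hE' : ∀ z ∈ E, |z - x| < δ₁ → |v z - v x - u x * (z - x)| ≤ ε * |z - x| := by
    intro z hz hzx
    have := h1 ⟨Metric.mem_ball.2 (by rwa [Real.dist_eq]), hz⟩
    simpa [mul_comm] using this
  rw [Real.dist_eq] at hy1 hy2
  rw [smul_eq_mul, mul_comm (y - x), Real.norm_eq_abs, Real.norm_eq_abs]
  by_cases hyE : y ∈ E
  · exact hE' y hyE hy1
  have hg := hE.isGap hyE
  obtain ⟨hc, hd⟩ := hgap _ _ hg
  have hl := hE.leftPt_lt hyE
  have hr := hE.lt_rightPt hyE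
  rcases le_total x y with hxy | hxy
  · have hxl := le_leftPt hx hxy
    rw [abs_of_nonneg (sub_nonneg.2 hxy)] at hy1 hy2 ⊢
    have e1 := hE' _ hg.left_mem (by rw [abs_of_nonneg (by linarith)]; linarith)
    rw [abs_of_nonneg (sub_nonneg.2 hxl)] at e1
    have e2 := abs_increment_sub_le (c := u x) (ε := ε) hl.le
      (hc.mono (Set.Icc_subset_Icc_right hr.le)) (fun z hz => hd z ⟨hz.1, hz.2.trans hr⟩)
      (fun z hz => (h2 z (by
        rw [Real.dist_eq, abs_of_nonneg (by linarith [hz.1])]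
        linarith [hz.2])).le)
    rw [abs_le] at *
    constructor <;> linarith
  · have hxr := rightPt_le hx hxy
    rw [abs_of_nonpos (sub_nonpos.2 hxy)] at hy1 hy2 ⊢
    have e1 := hE' _ hg.right_mem (by rw [abs_of_nonpos (by linarith)]; linarith)
    rw [abs_of_nonpos (sub_nonpos.2 hxr)] at e1
    have e2 := abs_increment_sub_le (c := u x) (ε := ε) hr.le
      (hc.mono (Set.Icc_subset_Icc_left hl.le)) (fun z hz => hd z ⟨hl.trans hz.1, hz.2⟩)
      (fun z hz => (h2 z (by
        rw [Real.dist_eq, abs_of_nonpos (by linarith [hz.2])]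
        linarith [hz.1])).le)
    rw [abs_le] at *
    constructor <;> linarith

/-- If E meets [x, y], pass through the first point of E after x and the last one before y: three
steps of length at most |y - x|, hence the factor 3. Otherwise x and y lie in one gap. -/
theorem hasModulus_of_gaps {ω : ℝ≥0∞ → ℝ≥0∞} (hω : IsModulus ω) (hE : IsTwoSided E)
    {u : ℝ → ℝ} {C : ℝ} (hC : 0 < C)
    (huE : ∀ x ∈ E, ∀ y ∈ E, |u y - u x| ≤ C * modVal ω |y - x|)
    (hgap : ∀ a b, IsGap E a b → ∀ x ∈ Set.Icc a b, ∀ y ∈ Set.Icc a b,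
      |u y - u x| ≤ C * modVal ω |y - x|) : HasModulus ω u := by
  have hr : ∀ x, |u (rightPt E x) - u x| ≤ C * modVal ω |rightPt E x - x| := by
    intro x
    by_cases hx : x ∈ E
    · exact huE x hx _ (hE.rightPt_mem x).1
    · have hg := hE.isGap hx
      exact hgap _ _ hg x ⟨(hE.leftPt_lt hx).le, (hE.lt_rightPt hx).le⟩ _ ⟨hg.lt.le, le_rfl⟩
  have hl : ∀ x, |u x - u (leftPt E x)| ≤ C * modVal ω |x - leftPt E x| := by
    intro x
    by_cases hx : x ∈ E
    · exact huE _ (hE.leftPt_mem x).1 x hx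
    · have hg := hE.isGap hx
      exact hgap _ _ hg _ ⟨le_rfl, hg.lt.le⟩ x ⟨(hE.leftPt_lt hx).le, (hE.lt_rightPt hx).le⟩
  have key : ∀ x y, x ≤ y → |u y - u x| ≤ 3 * C * modVal ω |y - x| := by
    intro x y hxy
    have hC' : 0 ≤ C * modVal ω |y - x| := mul_nonneg hC.le (modVal_nonneg _ _)
    by_cases h : ∃ e ∈ E, x ≤ e ∧ e ≤ y
    · obtain ⟨e, he, hxe, hey⟩ := h
      have h1 := rightPt_le he hxe
      have h2 := le_leftPt he hey
      have h3 : x ≤ rightPt E x := (hE.rightPt_mem x).2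
      have h4 : leftPt E y ≤ y := (hE.leftPt_mem y).2
      have hmono : ∀ s t, s ≤ t → x ≤ s → t ≤ y →
          C * modVal ω |t - s| ≤ C * modVal ω |y - x| := by
        intro s t hst hs ht
        rw [abs_of_nonneg (by linarith), abs_of_nonneg (by linarith)]
        exact mul_le_mul_of_nonneg_left (hω.modVal_mono (by linarith)) hC.le
      have e1 := (hr x).trans (hmono _ _ h3 le_rfl (by linarith))
      have e2 := (hl y).trans (hmono _ _ h4 (by linarith) le_rfl)
      have e3 := (huE _ (hE.rightPt_mem x).1 _ (hE.leftPt_mem y).1).trans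
        (hmono _ _ (by linarith) h3 h4)
      rw [abs_le] at *
      constructor <;> linarith
    · have hx : x ∉ E := fun hx => h ⟨x, hx, le_rfl, hxy⟩
      have hy : y < rightPt E x := by
        by_contra! hy
        exact h ⟨_, (hE.rightPt_mem x).1, (hE.rightPt_mem x).2, hy⟩
      have hlx := hE.leftPt_lt hx
      have := hgap _ _ (hE.isGap hx) x ⟨hlx.le, hxy.trans hy.le⟩ y ⟨hlx.le.trans hxy, hy.le⟩
      linarith
  refine ⟨3 * C, by positivity, fun x y => ?_⟩
  rcases le_total x y with h | h
  · exact key x y h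
  · rw [abs_sub_comm, abs_sub_comm y x]
    exact key y x h

end Gluing

/-! ### Rescaling between a gap and the unit interval. -/

section GapFunctions

open Polynomial

/-- The `k`-th derivative of the polynomial `p` transported from `[0, 1]` to `[a, b]`. -/
noncomputable def gapFun (a b : ℝ) (p : ℝ[X]) (k : ℕ) (x : ℝ) : ℝ :=
  ((b - a) ^ k)⁻¹ * (derivative^[k] p).eval ((x - a) / (b - a))

theorem hasDerivAt_gapFun (a b : ℝ) (p : ℝ[X]) (k : ℕ) (x : ℝ) :
    HasDerivAt (gapFun a b p k) (gapFun a b p (k + 1) x) x := by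
  have h1 : HasDerivAt (fun x => (x - a) / (b - a)) (1 / (b - a)) x :=
    ((hasDerivAt_id x).sub_const a).div_const _
  have h2 := (((derivative^[k] p).hasDerivAt ((x - a) / (b - a))).comp x h1).const_mul
    ((b - a) ^ k)⁻¹
  refine h2.congr_deriv ?_
  rw [gapFun, Function.iterate_succ_apply', pow_succ, mul_inv]
  ring

theorem continuous_gapFun (a b : ℝ) (p : ℝ[X]) (k : ℕ) : Continuous (gapFun a b p k) :=
  continuous_iff_continuousAt.2 fun x => (hasDerivAt_gapFun a b p k x).continuousAt

theorem gapFun_left (a b : ℝ) (p : ℝ[X]) (k : ℕ) :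
    gapFun a b p k a = ((b - a) ^ k)⁻¹ * (derivative^[k] p).eval 0 := by
  simp [gapFun]

theorem gapFun_right {a b : ℝ} (hab : a < b) (p : ℝ[X]) (k : ℕ) :
    gapFun a b p k b = ((b - a) ^ k)⁻¹ * (derivative^[k] p).eval 1 := by
  rw [gapFun, div_self (sub_pos.2 hab).ne']

/-- The area form is invariant under reparametrization, so no power of b - a appears. -/
theorem integral_gapFun {a b : ℝ} (hab : a < b) (p q : ℝ[X]) :
    ∫ x in a..b, (gapFun a b p 1 x * gapFun a b q 0 x - gapFun a b q 1 x * gapFun a b p 0 x) =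
      areaForm p q := by
  have hL : b - a ≠ 0 := (sub_pos.2 hab).ne'
  have h := intervalIntegral.integral_comp_mul_add (a := 0) (b := 1)
    (fun x => gapFun a b p 1 x * gapFun a b q 0 x - gapFun a b q 1 x * gapFun a b p 0 x) hL a
  rw [mul_zero, zero_add, mul_one, sub_add_cancel, smul_eq_mul] at h
  rw [← mul_right_inj' (inv_ne_zero hL), ← h, areaForm, unitIntegral_apply,
    ← intervalIntegral.integral_const_mul]
  refine intervalIntegral.integral_congr fun x _ => ?_
  simp [gapFun, hL]
  ring

/-- The derivative of order m + 1 on the gap is at most C ω(L)/L, L = b - a. So the m-th one is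
Lipschitz with this constant, and ω(L)/L ≤ ω(s)/s for 0 < s ≤ L by concavity. -/
theorem gapFun_modulus {ω : ℝ≥0∞ → ℝ≥0∞} (hω : IsModulus ω) {m : ℕ} {a b C : ℝ} (hC : 0 ≤ C)
    (hab : a < b) {p : ℝ[X]}
    (hp : ∀ x ∈ Set.Icc (0 : ℝ) 1,
      |(derivative^[m + 1] p).eval x| ≤ C * (modVal ω (b - a) * (b - a) ^ m)) :
    ∀ x ∈ Set.Icc a b, ∀ y ∈ Set.Icc a b,
      |gapFun a b p m y - gapFun a b p m x| ≤ C * modVal ω |y - x| := by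
  intro x hx y hy
  have hL : 0 < b - a := sub_pos.2 hab
  have hbd : ∀ z ∈ Set.Icc a b, ‖gapFun a b p (m + 1) z‖ ≤ C * modVal ω (b - a) / (b - a) := by
    intro z hz
    have h1 := hp ((z - a) / (b - a))
      ⟨div_nonneg (sub_nonneg.2 hz.1) hL.le, (div_le_one hL).2 (by linarith [hz.2])⟩
    rw [gapFun, norm_mul, Real.norm_of_nonneg (by positivity), Real.norm_eq_abs]
    calc _ ≤ ((b - a) ^ (m + 1))⁻¹ * (C * (modVal ω (b - a) * (b - a) ^ m)) := by gcongr
      _ = _ := by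
        rw [pow_succ]
        field_simp
  have h2 := (convex_Icc a b).norm_image_sub_le_of_norm_hasDerivWithin_le
    (fun z _ => (hasDerivAt_gapFun a b p m z).hasDerivWithinAt) hbd hx hy
  rw [Real.norm_eq_abs, Real.norm_eq_abs] at h2
  refine h2.trans ?_
  have h3 : |y - x| ≤ b - a := by
    rw [abs_le]
    constructor <;> linarith [hx.1, hx.2, hy.1, hy.2]
  have h4 := hω.mul_modVal_le (abs_nonneg (y - x)) h3
  rw [div_mul_eq_mul_div, div_le_iff₀ hL]
  calc C * modVal ω (b - a) * |y - x| = C * (|y - x| * modVal ω (b - a)) := by ring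
    _ ≤ C * ((b - a) * modVal ω |y - x|) := by gcongr
    _ = _ := by ring

/-- Transporting Taylor polynomials from `[a, a + L]` to `[0, 1]`. -/
theorem taylorPoly_comp (m : ℕ) (F : ℕ → ℝ → ℝ) (a L : ℝ) :
    (taylorPoly m F a).comp (C L * X + C a) = taylorPoly m (fun k _ => L ^ k * F k a) 0 := by
  refine Polynomial.funext fun x => ?_
  rw [eval_comp, taylorPoly_eval, taylorPoly_eval]
  refine Finset.sum_congr rfl fun k _ => ?_
  simp only [eval_add, eval_mul, eval_C, eval_X, add_sub_cancel_right, sub_zero, mul_pow]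
  ring

theorem derivative_taylorPoly_comp (m : ℕ) (F : ℕ → ℝ → ℝ) (a L x : ℝ) :
    (derivative (taylorPoly m (fun k _ => L ^ k * F k a) 0)).eval x =
      L * (derivative (taylorPoly m F a)).eval (L * x + a) := by
  rw [← taylorPoly_comp, derivative_comp, eval_mul, eval_comp]
  simp

theorem areaForm_taylorPoly (m : ℕ) (F G : ℕ → ℝ → ℝ) {a b : ℝ} (hab : a < b) :
    areaForm (taylorPoly m (fun k _ => (b - a) ^ k * F k a) 0)
      (taylorPoly m (fun k _ => (b - a) ^ k * G k a) 0) =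
    ∫ x in a..b, ((taylorPoly m F a).derivative.eval x * (taylorPoly m G a).eval x
          - (taylorPoly m G a).derivative.eval x * (taylorPoly m F a).eval x) := by
  have hL : b - a ≠ 0 := (sub_pos.2 hab).ne'
  have h := intervalIntegral.integral_comp_mul_add (a := 0) (b := 1)
    (fun x => (taylorPoly m F a).derivative.eval x * (taylorPoly m G a).eval x
          - (taylorPoly m G a).derivative.eval x * (taylorPoly m F a).eval x) hL a
  rw [mul_zero, zero_add, mul_one, sub_add_cancel, smul_eq_mul] at h
  rw [← mul_right_inj' (inv_ne_zero hL), ← h, areaForm, unitIntegral_apply,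
    ← intervalIntegral.integral_const_mul]
  refine intervalIntegral.integral_congr fun x _ => ?_
  rw [eval_sub, eval_mul, eval_mul, derivative_taylorPoly_comp, derivative_taylorPoly_comp,
    ← taylorPoly_comp, ← taylorPoly_comp, eval_comp, eval_comp]
  simp only [eval_add, eval_mul, eval_C, eval_X]
  field_simp

/-- Bounds the velocity from above by the coefficient norms in which `exists_gap_polynomials` is
stated. -/
theorem integral_abs_derivative_taylorPoly_le (m : ℕ) (F G : ℕ → ℝ → ℝ) {a b : ℝ} (hab : a < b) :
    ∫ x in a..b, (|(taylorPoly m F a).derivative.eval x| +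
        |(taylorPoly m G a).derivative.eval x|) ≤
      coeffNorm (derivative (taylorPoly m (fun k _ => (b - a) ^ k * F k a) 0)) +
      coeffNorm (derivative (taylorPoly m (fun k _ => (b - a) ^ k * G k a) 0)) := by
  have hL : 0 < b - a := sub_pos.2 hab
  have hbd : ∀ F : ℕ → ℝ → ℝ, ∀ x ∈ Set.Icc a b, |(taylorPoly m F a).derivative.eval x| ≤
      coeffNorm (derivative (taylorPoly m (fun k _ => (b - a) ^ k * F k a) 0)) / (b - a) := by
    intro F x hx
    have h1 := abs_eval_le_coeffNorm
      (derivative (taylorPoly m (fun k _ => (b - a) ^ k * F k a) 0)) (x := (x - a) / (b - a))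
      ⟨div_nonneg (sub_nonneg.2 hx.1) hL.le, (div_le_one hL).2 (by linarith [hx.2])⟩
    rw [derivative_taylorPoly_comp, abs_mul, abs_of_pos hL, mul_div_cancel₀ _ hL.ne',
      sub_add_cancel] at h1
    rw [le_div_iff₀ hL]
    linarith
  have h2 := intervalIntegral.integral_mono_on hab.le
    ((by fun_prop : Continuous fun x => |(taylorPoly m F a).derivative.eval x| +
        |(taylorPoly m G a).derivative.eval x|).intervalIntegrable (μ := volume) a b)
    (intervalIntegrable_const (c :=
      coeffNorm (derivative (taylorPoly m (fun k _ => (b - a) ^ k * F k a) 0)) / (b - a) +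
      coeffNorm (derivative (taylorPoly m (fun k _ => (b - a) ^ k * G k a) 0)) / (b - a)))
    (fun x hx => add_le_add (hbd F x hx) (hbd G x hx))
  refine h2.trans (le_of_eq ?_)
  rw [intervalIntegral.integral_const, smul_eq_mul]
  field_simp

end GapFunctions

/-! ### Extension across all gaps of a two-sided set. -/

section Extension

open Polynomial

/-- `exists_gap_polynomials` is applied with W = ω(L) L^m, L = b - a: rescaling multiplies the k-th
remainder, O(ω(L) L^(m-k)), by L^k, and the area defect becomes half of `areaDiscrepancy`. The
constant depends on m and C₀ but not on the gap, which makes gluing possible. -/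
theorem exists_gap_data (m : ℕ) {ω : ℝ≥0∞ → ℝ≥0∞} (hω : IsModulus ω) {C₀ : ℝ} (hC₀ : 0 ≤ C₀) :
    ∃ C₁ : ℝ, 0 ≤ C₁ ∧ ∀ (F G H : ℕ → ℝ → ℝ) (a b : ℝ), a < b →
      (∀ k ≤ m, |F k b - (taylorPoly (m - k) (fun l => F (k + l)) a).eval b| ≤
        C₀ * modVal ω (b - a) * (b - a) ^ (m - k)) →
      (∀ k ≤ m, |G k b - (taylorPoly (m - k) (fun l => G (k + l)) a).eval b| ≤
        C₀ * modVal ω (b - a) * (b - a) ^ (m - k)) →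
      |areaDiscrepancy m F G H a b| ≤ C₀ * velocity m ω F G a b →
      ∃ p q : ℝ[X], (∀ k ≤ m, gapFun a b p k a = F k a ∧ gapFun a b p k b = F k b) ∧
        (∀ k ≤ m, gapFun a b q k a = G k a ∧ gapFun a b q k b = G k b) ∧
        (∀ x ∈ Set.Icc a b, ∀ y ∈ Set.Icc a b,
          |gapFun a b p m y - gapFun a b p m x| ≤ C₁ * modVal ω |y - x|) ∧
        (∀ x ∈ Set.Icc a b, ∀ y ∈ Set.Icc a b,
          |gapFun a b q m y - gapFun a b q m x| ≤ C₁ * modVal ω |y - x|) ∧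
        areaForm p q = (H 0 b - H 0 a) / 2 := by
  obtain ⟨C₁, hC₁, hpoly⟩ := exists_gap_polynomials m hC₀
  refine ⟨C₁, hC₁, fun F G H a b hab hF hG hA => ?_⟩
  have hL : 0 < b - a := sub_pos.2 hab
  have hw : 0 < modVal ω (b - a) := hω.modVal_pos hL
  have hr : ∀ F : ℕ → ℝ → ℝ, (∀ k ≤ m,
      |F k b - (taylorPoly (m - k) (fun l => F (k + l)) a).eval b| ≤
        C₀ * modVal ω (b - a) * (b - a) ^ (m - k)) → ∀ k ≤ m,
      |(b - a) ^ k * (F k b - (taylorPoly (m - k) (fun l => F (k + l)) a).eval b)| ≤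
        C₀ * (modVal ω (b - a) * (b - a) ^ m) := by
    intro F hF k hk
    rw [abs_mul, abs_of_pos (pow_pos hL k)]
    calc _ ≤ (b - a) ^ k * (C₀ * modVal ω (b - a) * (b - a) ^ (m - k)) := by
          gcongr
          exact hF k hk
      _ = C₀ * (modVal ω (b - a) * ((b - a) ^ k * (b - a) ^ (m - k))) := by ring
      _ = _ := by rw [← pow_add, Nat.add_sub_cancel' hk]
  have hjet : ∀ F : ℕ → ℝ → ℝ, ∀ k ≤ m,
      (derivative^[k] (taylorPoly m (fun k _ => (b - a) ^ k * F k a) 0)).eval 0 =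
        (b - a) ^ k * F k a ∧
      (derivative^[k] (taylorPoly m (fun k _ => (b - a) ^ k * F k a) 0)).eval 1 +
        (b - a) ^ k * (F k b - (taylorPoly (m - k) (fun l => F (k + l)) a).eval b) =
        (b - a) ^ k * F k b := by
    intro F k hk
    rw [iterate_derivative_taylorPoly _ _ hk]
    constructor
    · rw [taylorPoly_eval_self, add_zero]
    · rw [mul_sub, taylorPoly_eval, taylorPoly_eval, Finset.mul_sum]
      have : ∀ l ∈ Finset.range (m - k + 1),
          (b - a) ^ (k + l) * F (k + l) a / (l ! : ℝ) * (1 - 0) ^ l =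
          (b - a) ^ k * (F (k + l) a / (l ! : ℝ) * (b - a) ^ l) := by
        intro l _
        rw [pow_add]
        ring
      rw [Finset.sum_congr rfl this]
      ring
  set P := taylorPoly m (fun k _ => (b - a) ^ k * F k a) 0 with hP
  set Q := taylorPoly m (fun k _ => (b - a) ^ k * G k a) 0 with hQ
  obtain ⟨p, q, hp0, hq0, hp1, hq1, hpt, hqt, hpq⟩ := hpoly
    (modVal ω (b - a) * (b - a) ^ m) (by positivity) P Q (natDegree_taylorPoly_le _ _ _)
    (natDegree_taylorPoly_le _ _ _) _ _ (hr F hF) (hr G hG) ((H 0 b - H 0 a) / 2) (by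
      have e1 := areaForm_taylorPoly m F G hab
      rw [← hP, ← hQ] at e1
      have e2 : P.eval 0 = F 0 a := by simpa using (hjet F 0 (Nat.zero_le m)).1
      have e3 : Q.eval 0 = G 0 a := by simpa using (hjet G 0 (Nat.zero_le m)).1
      have e4 := integral_abs_derivative_taylorPoly_le m F G hab
      rw [← hP, ← hQ] at e4
      simp only [pow_zero, one_mul, Nat.sub_zero, zero_add]
      rw [e1, e2, e3]
      have e5 : (H 0 b - H 0 a) / 2 - (∫ x in a..b,
          ((taylorPoly m F a).derivative.eval x * (taylorPoly m G a).eval x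
          - (taylorPoly m G a).derivative.eval x * (taylorPoly m F a).eval x)) -
          (F 0 b - (taylorPoly m F a).eval b) * G 0 a +
          (G 0 b - (taylorPoly m G a).eval b) * F 0 a = areaDiscrepancy m F G H a b / 2 := by
        rw [areaDiscrepancy]
        ring
      rw [e5, abs_div, abs_two]
      have e6 : velocity m ω F G a b ≤ modVal ω (b - a) * (b - a) ^ m *
          (modVal ω (b - a) * (b - a) ^ m +
            (coeffNorm (derivative P) + coeffNorm (derivative Q))) := by
        have := mul_le_mul_of_nonneg_left e4
          (by positivity : 0 ≤ modVal ω (b - a) * (b - a) ^ m)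
        rw [velocity, two_mul m, pow_add]
        linarith
      have e7 := mul_le_mul_of_nonneg_left e6 hC₀
      have e8 := abs_nonneg (areaDiscrepancy m F G H a b)
      linarith)
  have hends : ∀ (F : ℕ → ℝ → ℝ) (p : ℝ[X]), (∀ k ≤ m, (derivative^[k] p).eval 0 =
      (b - a) ^ k * F k a) → (∀ k ≤ m, (derivative^[k] p).eval 1 = (b - a) ^ k * F k b) →
      ∀ k ≤ m, gapFun a b p k a = F k a ∧ gapFun a b p k b = F k b := by
    intro F p h0 h1 k hk
    rw [gapFun_left, gapFun_right hab, h0 k hk, h1 k hk]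
    constructor <;> field_simp
  exact ⟨p, q, hends F p (fun k hk => (hp0 k hk).trans (hjet F k hk).1)
      (fun k hk => (hp1 k hk).trans (hjet F k hk).2),
    hends G q (fun k hk => (hq0 k hk).trans (hjet G k hk).1)
      (fun k hk => (hq1 k hk).trans (hjet G k hk).2),
    gapFun_modulus hω hC₁ hab hpt, gapFun_modulus hω hC₁ hab hqt, hpq⟩

/-- Gluing jets on `E` with polynomials on its gaps. -/
theorem isJet_glue {m : ℕ} {ω : ℝ≥0∞ → ℝ≥0∞} (hω : IsModulus ω) {E : Set ℝ} (hE : IsTwoSided E)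
    {F : ℕ → ℝ → ℝ} {p : ℝ → ℝ → ℝ[X]} {C : ℝ} (hC : 0 < C)
    (hd : ∀ k < m, ∀ x ∈ E, HasDerivWithinAt (F k) (F (k + 1) x) E x)
    (hF : ∀ x ∈ E, ∀ y ∈ E, |F m y - F m x| ≤ C * modVal ω |y - x|)
    (hends : ∀ a b, IsGap E a b → ∀ k ≤ m,
      gapFun a b (p a b) k a = F k a ∧ gapFun a b (p a b) k b = F k b)
    (hgap : ∀ a b, IsGap E a b → ∀ x ∈ Set.Icc a b, ∀ y ∈ Set.Icc a b,
      |gapFun a b (p a b) m y - gapFun a b (p a b) m x| ≤ C * modVal ω |y - x|) :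
    IsJet m ω (fun k => glue E (F k) (fun a b => gapFun a b (p a b) k)) := by
  set f : ℕ → ℝ → ℝ := fun k => glue E (F k) (fun a b => gapFun a b (p a b) k) with hf
  have hfE : ∀ k, ∀ x ∈ E, f k x = F k x := fun k x hx => glue_of_mem hx
  have hfg : ∀ k ≤ m, ∀ a b, IsGap E a b → ∀ x ∈ Set.Icc a b, f k x = gapFun a b (p a b) k x :=
    fun k hk a b h x hx => h.glue_eq hE (p := fun a b => gapFun a b (p a b) k)
      (hends a b h k hk).1 (hends a b h k hk).2 hx
  have hmod : HasModulus ω (f m) := by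
    refine hasModulus_of_gaps hω hE hC (fun x hx y hy => ?_) (fun a b h x hx y hy => ?_)
    · rw [hfE m x hx, hfE m y hy]
      exact hF x hx y hy
    · rw [hfg m le_rfl a b h x hx, hfg m le_rfl a b h y hy]
      exact hgap a b h x hx y hy
  have hder : ∀ k < m, Continuous (f (k + 1)) → ∀ x, HasDerivAt (f k) (f (k + 1) x) x := by
    intro k hk hc
    refine hasDerivAt_of_gaps hE hc (fun a b h => ⟨?_, fun x hx => ?_⟩) (fun x hx => ?_)
    · exact (continuous_gapFun a b (p a b) k).continuousOn.congr fun x hx =>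
        hfg k hk.le a b h x hx
    · rw [hfg (k + 1) hk a b h x ⟨hx.1.le, hx.2.le⟩]
      refine (hasDerivAt_gapFun a b (p a b) k x).congr_of_eventuallyEq ?_
      filter_upwards [Icc_mem_nhds hx.1 hx.2] with y hy
      exact hfg k hk.le a b h y hy
    · rw [hfE (k + 1) x hx]
      exact (hd k hk x hx).congr (fun y hy => hfE k y hy) (hfE k x hx)
  -- Descending induction from order m, where continuity comes from the modulus: `hder` at k
  -- presupposes continuity at k + 1.
  have hcont : ∀ j k, k + j = m → Continuous (f k) := by
    intro j
    induction j with
    | zero =>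
      rintro k rfl
      exact hmod.continuous hω
    | succ j ih =>
      intro k hk
      exact continuous_iff_continuousAt.2 fun x =>
        (hder k (by omega) (ih (k + 1) (by omega)) x).continuousAt
  exact ⟨fun k hk => hder k hk (hcont (m - (k + 1)) (k + 1) (by omega)), hmod⟩

/-- Extension of jets with compatible areas from a two-sided closed set to the line. -/
theorem exists_extension {m : ℕ} (hm : 1 ≤ m) {ω : ℝ≥0∞ → ℝ≥0∞} (hω : IsModulus ω) {E : Set ℝ}
    (hE : IsTwoSided E) {F G H : ℕ → ℝ → ℝ} {C₀ : ℝ} (hC₀ : 0 ≤ C₀)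
    (hdF : ∀ k < m, ∀ x ∈ E, HasDerivWithinAt (F k) (F (k + 1) x) E x)
    (hdG : ∀ k < m, ∀ x ∈ E, HasDerivWithinAt (G k) (G (k + 1) x) E x)
    (hdH : ∀ x ∈ E, HasDerivWithinAt (H 0) (2 * (F 1 x * G 0 x - G 1 x * F 0 x)) E x)
    (hF : ∀ x ∈ E, ∀ y ∈ E, |F m y - F m x| ≤ C₀ * modVal ω |y - x|)
    (hG : ∀ x ∈ E, ∀ y ∈ E, |G m y - G m x| ≤ C₀ * modVal ω |y - x|)
    (hgF : ∀ a b, IsGap E a b → ∀ k ≤ m,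
      |F k b - (taylorPoly (m - k) (fun l => F (k + l)) a).eval b| ≤
        C₀ * modVal ω (b - a) * (b - a) ^ (m - k))
    (hgG : ∀ a b, IsGap E a b → ∀ k ≤ m,
      |G k b - (taylorPoly (m - k) (fun l => G (k + l)) a).eval b| ≤
        C₀ * modVal ω (b - a) * (b - a) ^ (m - k))
    (hA : ∀ a b, IsGap E a b →
      |areaDiscrepancy m F G H a b| ≤ C₀ * velocity m ω F G a b) :
    ∃ (f g : ℕ → ℝ → ℝ) (h : ℝ → ℝ), IsJet m ω f ∧ IsJet m ω g ∧
      (∀ x, HasDerivAt h (2 * (f 1 x * g 0 x - g 1 x * f 0 x)) x) ∧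
      (∀ k, ∀ x ∈ E, f k x = F k x) ∧ (∀ k, ∀ x ∈ E, g k x = G k x) ∧
      ∀ x ∈ E, h x = H 0 x := by
  obtain ⟨C₁, hC₁, hdata⟩ := exists_gap_data m hω hC₀
  -- Polynomials are chosen for all pairs at once, with the default 0 for pairs that are not gaps.
  have hpq : ∀ a b, ∃ p q : ℝ[X], IsGap E a b →
      (∀ k ≤ m, gapFun a b p k a = F k a ∧ gapFun a b p k b = F k b) ∧
      (∀ k ≤ m, gapFun a b q k a = G k a ∧ gapFun a b q k b = G k b) ∧
      (∀ x ∈ Set.Icc a b, ∀ y ∈ Set.Icc a b,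
        |gapFun a b p m y - gapFun a b p m x| ≤ C₁ * modVal ω |y - x|) ∧
      (∀ x ∈ Set.Icc a b, ∀ y ∈ Set.Icc a b,
        |gapFun a b q m y - gapFun a b q m x| ≤ C₁ * modVal ω |y - x|) ∧
      areaForm p q = (H 0 b - H 0 a) / 2 := by
    intro a b
    by_cases hab : IsGap E a b
    · obtain ⟨p, q, h⟩ := hdata F G H a b hab.lt (hgF a b hab) (hgG a b hab) (hA a b hab)
      exact ⟨p, q, fun _ => h⟩
    · exact ⟨0, 0, fun h => absurd h hab⟩
  choose p q hpq using hpq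
  set C := C₀ + C₁ + 1 with hC
  have hC0 : 0 < C := by positivity
  have hle : ∀ {c t : ℝ}, c ≤ C → ∀ {z : ℝ}, z ≤ c * modVal ω t → z ≤ C * modVal ω t :=
    fun h _ hz => hz.trans (mul_le_mul_of_nonneg_right h (modVal_nonneg _ _))
  have hjf := isJet_glue hω hE hC0 hdF (fun x hx y hy => hle (by linarith) (hF x hx y hy))
    (fun a b h => (hpq a b h).1)
    (fun a b h x hx y hy => hle (by linarith) ((hpq a b h).2.2.1 x hx y hy))
  have hjg := isJet_glue hω hE hC0 hdG (fun x hx y hy => hle (by linarith) (hG x hx y hy))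
    (fun a b h => (hpq a b h).2.1)
    (fun a b h x hx y hy => hle (by linarith) ((hpq a b h).2.2.2.1 x hx y hy))
  set f : ℕ → ℝ → ℝ := fun k => glue E (F k) (fun a b => gapFun a b (p a b) k) with hf
  set g : ℕ → ℝ → ℝ := fun k => glue E (G k) (fun a b => gapFun a b (q a b) k) with hg
  have hfE : ∀ k, ∀ x ∈ E, f k x = F k x := fun k x hx => glue_of_mem hx
  have hgE : ∀ k, ∀ x ∈ E, g k x = G k x := fun k x hx => glue_of_mem hx
  have hfg : ∀ k ≤ m, ∀ a b, IsGap E a b → ∀ x ∈ Set.Icc a b, f k x = gapFun a b (p a b) k x :=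
    fun k hk a b h x hx => h.glue_eq hE (p := fun a b => gapFun a b (p a b) k)
      ((hpq a b h).1 k hk).1 ((hpq a b h).1 k hk).2 hx
  have hgg : ∀ k ≤ m, ∀ a b, IsGap E a b → ∀ x ∈ Set.Icc a b, g k x = gapFun a b (q a b) k x :=
    fun k hk a b h x hx => h.glue_eq hE (p := fun a b => gapFun a b (q a b) k)
      ((hpq a b h).2.1 k hk).1 ((hpq a b h).2.1 k hk).2 hx
  have hf0 := hjf.continuous hω (Nat.zero_le m)
  have hf1 := hjf.continuous hω hm
  have hg0 := hjg.continuous hω (Nat.zero_le m)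
  have hg1 := hjg.continuous hω hm
  have hu : Continuous fun x => 2 * (f 1 x * g 0 x - g 1 x * f 0 x) := by fun_prop
  -- The horizontal lift started from H(a); the dummy argument is the right end, which `glue`
  -- expects.
  let prim : ℝ → ℝ → ℝ → ℝ := fun a _ x =>
    H 0 a + ∫ t in a..x, 2 * (f 1 t * g 0 t - g 1 t * f 0 t)
  have hprim : ∀ a b x, HasDerivAt (prim a b) (2 * (f 1 x * g 0 x - g 1 x * f 0 x)) x :=
    fun a b x => (hu.integral_hasStrictDerivAt a x).hasDerivAt.const_add _
  have hprim0 : ∀ a b, prim a b a = H 0 a := fun a b => by simp [prim]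
  -- The prescribed area makes the lift arrive at H(b).
  have hprim1 : ∀ a b, IsGap E a b → prim a b b = H 0 b := by
    intro a b h
    have h1 : ∫ t in a..b, (f 1 t * g 0 t - g 1 t * f 0 t) = areaForm (p a b) (q a b) := by
      rw [← integral_gapFun h.lt]
      refine intervalIntegral.integral_congr fun x hx => ?_
      rw [Set.uIcc_of_le h.lt.le] at hx
      simp only [hfg 0 (Nat.zero_le m) a b h x hx, hfg 1 hm a b h x hx,
        hgg 0 (Nat.zero_le m) a b h x hx, hgg 1 hm a b h x hx]
    simp only [prim]
    rw [intervalIntegral.integral_const_mul, h1, (hpq a b h).2.2.2.2]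
    ring
  have hhg : ∀ a b, IsGap E a b → ∀ x ∈ Set.Icc a b, glue E (H 0) prim x = prim a b x :=
    fun a b h x hx => h.glue_eq hE (hprim0 a b) (hprim1 a b h) hx
  refine ⟨f, g, glue E (H 0) prim, hjf, hjg, ?_, hfE, hgE, fun x hx => glue_of_mem hx⟩
  refine hasDerivAt_of_gaps hE hu (fun a b h => ⟨?_, fun x hx => ?_⟩) (fun x hx => ?_)
  · have : Continuous (prim a b) := continuous_iff_continuousAt.2 fun x =>
      (hprim a b x).continuousAt
    exact this.continuousOn.congr fun x hx => hhg a b h x hx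
  · refine (hprim a b x).congr_of_eventuallyEq ?_
    filter_upwards [Icc_mem_nhds hx.1 hx.2] with y hy
    exact hhg a b h y hy
  · simp only [hfE _ x hx, hgE _ x hx]
    exact (hdH x hx).congr (fun y hy => glue_of_mem hy) (glue_of_mem hx)

end Extension

/-! ### Dependence on the values of the jets at the points involved. -/

section Congruence

theorem taylorPoly_congr {m : ℕ} {F F' : ℕ → ℝ → ℝ} {a : ℝ} (h : ∀ k ≤ m, F k a = F' k a) :
    taylorPoly m F a = taylorPoly m F' a := by
  refine Finset.sum_congr rfl fun k hk => ?_
  rw [h k (Nat.lt_succ_iff.1 (Finset.mem_range.1 hk))]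

theorem IsWhitneyField.congr {m : ℕ} {ω : ℝ≥0∞ → ℝ≥0∞} {K : Set ℝ} {F F' : ℕ → ℝ → ℝ}
    (h : IsWhitneyField m ω K F) (hF : ∀ k ≤ m, ∀ x ∈ K, F k x = F' k x) :
    IsWhitneyField m ω K F' := by
  obtain ⟨C, hC, h⟩ := h
  refine ⟨C, hC, fun k hk a ha b hb => ?_⟩
  rw [← hF k hk b hb, ← taylorPoly_congr fun l hl => hF (k + l) (by omega) a ha]
  exact h k hk a ha b hb

theorem areaDiscrepancy_congr {m : ℕ} {F F' G G' H H' : ℕ → ℝ → ℝ} {a b : ℝ}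
    (hFa : ∀ k ≤ m, F k a = F' k a) (hGa : ∀ k ≤ m, G k a = G' k a) (hHa : H 0 a = H' 0 a)
    (hFb : F 0 b = F' 0 b) (hGb : G 0 b = G' 0 b) (hHb : H 0 b = H' 0 b) :
    areaDiscrepancy m F G H a b = areaDiscrepancy m F' G' H' a b := by
  simp only [areaDiscrepancy, taylorPoly_congr hFa, taylorPoly_congr hGa, hHa, hFb, hGb, hHb,
    hFa 0 (Nat.zero_le m), hGa 0 (Nat.zero_le m)]

theorem velocity_congr {m : ℕ} {ω : ℝ≥0∞ → ℝ≥0∞} {F F' G G' : ℕ → ℝ → ℝ} {a b : ℝ}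
    (hFa : ∀ k ≤ m, F k a = F' k a) (hGa : ∀ k ≤ m, G k a = G' k a) :
    velocity m ω F G a b = velocity m ω F' G' a b := by
  simp only [velocity, taylorPoly_congr hFa, taylorPoly_congr hGa]

theorem liftDeriv_congr {m : ℕ} {F F' G G' : ℕ → ℝ → ℝ} {x : ℝ} (hF : ∀ k ≤ m, F k x = F' k x)
    (hG : ∀ k ≤ m, G k x = G' k x) {k : ℕ} (hk : k ≤ m) :
    liftDeriv F G k x = liftDeriv F' G' k x := by
  unfold liftDeriv
  congr 1
  refine Finset.sum_congr rfl fun i hi => ?_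
  have := Finset.mem_range.1 hi
  rw [hF _ (by omega), hF _ (by omega), hG _ (by omega), hG _ (by omega)]

end Congruence

/-! ### The three conditions for a horizontal curve. -/

section NecessityConclusion

theorem conditions_of_horizontal {m : ℕ} (hm : 1 ≤ m) {ω : ℝ≥0∞ → ℝ≥0∞} (hω : IsModulus ω)
    {Γ : ℝ → EuclideanSpace ℝ (Fin 3)} (hhor : IsHorizontalCurve Γ) (hΓ : IsCmOmega m ω Γ)
    {K : Set ℝ} {F G H : ℕ → ℝ → ℝ}
    (hjet : ∀ k ≤ m, ∀ x ∈ K, iteratedDeriv k Γ x = !₂[F k x, G k x, H k x]) :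
    (IsWhitneyField m ω K F ∧ IsWhitneyField m ω K G ∧ IsWhitneyField m ω K H) ∧
      (∀ k, 1 ≤ k → k ≤ m → ∀ x ∈ K, H k x = liftDeriv F G k x) ∧
      ∃ C : ℝ, 1 ≤ C ∧ ∀ a ∈ K, ∀ b ∈ K, a < b →
        |areaDiscrepancy m F G H a b| ≤ C * velocity m ω F G a b := by
  set f : ℕ → ℝ → ℝ := fun k x => iteratedDeriv k Γ x 0 with hf
  set g : ℕ → ℝ → ℝ := fun k x => iteratedDeriv k Γ x 1 with hg
  set h : ℕ → ℝ → ℝ := fun k x => iteratedDeriv k Γ x 2 with hh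
  have hjf : IsJet m ω f := hΓ.isJet hω 0
  have hjg : IsJet m ω g := hΓ.isJet hω 1
  have hjh : IsJet m ω h := hΓ.isJet hω 2
  have hfK : ∀ k ≤ m, ∀ x ∈ K, f k x = F k x := fun k hk x hx => by simp [hf, hjet k hk x hx]
  have hgK : ∀ k ≤ m, ∀ x ∈ K, g k x = G k x := fun k hk x hx => by simp [hg, hjet k hk x hx]
  have hhK : ∀ k ≤ m, ∀ x ∈ K, h k x = H k x := fun k hk x hx => by simp [hh, hjet k hk x hx]
  have hlift1 : ∀ x, h 1 x = 2 * (f 1 x * g 0 x - g 1 x * f 0 x) := by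
    intro x
    have := hhor.deriv_eq (hΓ.1.of_le (by exact_mod_cast hm)) x
    simpa [hf, hg, hh, iteratedDeriv_one] using this
  -- The contact equation differentiated n times, by uniqueness of derivatives.
  have hlift : ∀ n, n + 1 ≤ m → ∀ x, h (n + 1) x = liftDeriv f g (n + 1) x := by
    intro n
    induction n with
    | zero =>
      intro _ x
      rw [zero_add, liftDeriv_one, hlift1]
    | succ n ih =>
      intro hn x
      have h1 := hjh.1 (n + 1) (by omega) x
      rw [show h (n + 1) = liftDeriv f g (n + 1) from funext (ih (by omega))] at h1
      exact h1.unique (hasDerivAt_liftDeriv hjf.1 hjg.1 (by omega) (by omega) x)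
  refine ⟨⟨(isWhitneyField_of_hasDerivAt hω hjf.1 hjf.2 K).congr hfK,
    (isWhitneyField_of_hasDerivAt hω hjg.1 hjg.2 K).congr hgK,
    (isWhitneyField_of_hasDerivAt hω hjh.1 hjh.2 K).congr hhK⟩, ?_, ?_⟩
  · intro k hk hkm x hx
    obtain ⟨n, rfl⟩ : ∃ n, k = n + 1 := ⟨k - 1, by omega⟩
    rw [← hhK _ hkm x hx, hlift n hkm,
      liftDeriv_congr (fun l hl => hfK l hl x hx) (fun l hl => hgK l hl x hx) hkm]
  · obtain ⟨C, hC, hA⟩ := abs_areaDiscrepancy_le hm hω hjf hjg (H := h) fun x => by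
      rw [← hlift1]
      exact hjh.1 0 (by omega) x
    refine ⟨C, hC, fun a ha b hb hab => ?_⟩
    rw [← areaDiscrepancy_congr (fun k hk => hfK k hk a ha) (fun k hk => hgK k hk a ha)
      (hhK 0 (by omega) a ha) (hfK 0 (by omega) b hb) (hgK 0 (by omega) b hb)
      (hhK 0 (by omega) b hb), ← velocity_congr (fun k hk => hfK k hk a ha)
      (fun k hk => hgK k hk a ha)]
    exact hA a b hab

end NecessityConclusion

/-! ### Bounded functions with modulus ω, for the regularity of the lift. -/

section BoundedModulus

/-- Bounded functions with modulus of continuity a multiple of `ω`. -/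
def IsBddModulus (ω : ℝ≥0∞ → ℝ≥0∞) (f : ℝ → ℝ) : Prop :=
  HasModulus ω f ∧ ∃ M : ℝ, 0 ≤ M ∧ ∀ x, |f x| ≤ M

variable {ω : ℝ≥0∞ → ℝ≥0∞} {f g : ℝ → ℝ}

/-- A modulus alone does not pass to products; the bounds on the factors are needed. -/
theorem IsBddModulus.mul (hf : IsBddModulus ω f) (hg : IsBddModulus ω g) :
    IsBddModulus ω (fun x => f x * g x) := by
  obtain ⟨⟨C₁, hC₁, h1⟩, M₁, hM₁, b1⟩ := hf
  obtain ⟨⟨C₂, hC₂, h2⟩, M₂, hM₂, b2⟩ := hg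
  refine ⟨⟨M₁ * C₂ + M₂ * C₁ + 1, by positivity, fun x y => ?_⟩, M₁ * M₂, by positivity,
    fun x => ?_⟩
  · have hw := modVal_nonneg ω |y - x|
    calc |f y * g y - f x * g x| = |f y * (g y - g x) + g x * (f y - f x)| := by ring_nf
      _ ≤ |f y| * |g y - g x| + |g x| * |f y - f x| := by
        rw [← abs_mul, ← abs_mul]
        exact abs_add_le _ _
      _ ≤ M₁ * (C₂ * modVal ω |y - x|) + M₂ * (C₁ * modVal ω |y - x|) := by
        gcongr
        exacts [b1 y, h2 x y, b2 x, h1 x y]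
      _ ≤ _ := by linarith
  · rw [abs_mul]
    exact mul_le_mul (b1 x) (b2 x) (abs_nonneg _) hM₁

theorem IsBddModulus.add (hf : IsBddModulus ω f) (hg : IsBddModulus ω g) :
    IsBddModulus ω (fun x => f x + g x) := by
  obtain ⟨⟨C₁, hC₁, h1⟩, M₁, hM₁, b1⟩ := hf
  obtain ⟨⟨C₂, hC₂, h2⟩, M₂, hM₂, b2⟩ := hg
  refine ⟨⟨C₁ + C₂, by positivity, fun x y => ?_⟩, M₁ + M₂, by positivity, fun x => ?_⟩
  · rw [add_sub_add_comm, add_mul]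
    exact (abs_add_le _ _).trans (add_le_add (h1 x y) (h2 x y))
  · exact (abs_add_le _ _).trans (add_le_add (b1 x) (b2 x))

theorem isBddModulus_const (ω : ℝ≥0∞ → ℝ≥0∞) (c : ℝ) : IsBddModulus ω (fun _ => c) :=
  ⟨⟨1, one_pos, fun x y => by simpa using modVal_nonneg ω |y - x|⟩, |c|, abs_nonneg _,
    fun _ => le_rfl⟩

theorem IsBddModulus.sub (hf : IsBddModulus ω f) (hg : IsBddModulus ω g) :
    IsBddModulus ω (fun x => f x - g x) := by
  have := hf.add ((isBddModulus_const ω (-1)).mul hg)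
  simpa [sub_eq_add_neg] using this

theorem isBddModulus_sum {ι : Type*} (s : Finset ι) {f : ι → ℝ → ℝ}
    (h : ∀ i ∈ s, IsBddModulus ω (f i)) : IsBddModulus ω (fun x => ∑ i ∈ s, f i x) := by
  classical
  induction s using Finset.induction_on with
  | empty => simpa using isBddModulus_const ω 0
  | insert i s hi ih =>
    simp only [Finset.sum_insert hi]
    exact (h i (Finset.mem_insert_self _ _)).add
      (ih fun j hj => h j (Finset.mem_insert_of_mem hj))

theorem isBddModulus_liftDeriv {m : ℕ} {f g : ℕ → ℝ → ℝ} (hf : ∀ k ≤ m, IsBddModulus ω (f k))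
    (hg : ∀ k ≤ m, IsBddModulus ω (g k)) : IsBddModulus ω (liftDeriv f g m) := by
  refine (isBddModulus_const ω 2).mul (isBddModulus_sum _ fun i hi => ?_)
  have := Finset.mem_range.1 hi
  exact (isBddModulus_const ω _).mul
    (((hf _ (by omega)).mul (hg _ (by omega))).sub ((hg _ (by omega)).mul (hf _ (by omega))))

/-- For distances s ≤ 1 concavity gives s ω(1) ≤ ω(s), so the Lipschitz bound suffices; for s ≥ 1
one has ω(s) ≥ ω(1) and boundedness suffices. -/
theorem hasModulus_of_lipschitz (hω : IsModulus ω) {L M : ℝ} (hL : 0 ≤ L)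
    (hM : 0 ≤ M) (hlip : ∀ x y, |f y - f x| ≤ L * |y - x|) (hb : ∀ x, |f x| ≤ M) :
    HasModulus ω f := by
  have h1 := hω.modVal_pos one_pos
  refine ⟨(L + 2 * M + 1) / modVal ω 1, by positivity, fun x y => ?_⟩
  rw [div_mul_eq_mul_div, le_div_iff₀ h1]
  have hw := modVal_nonneg ω |y - x|
  rcases le_total |y - x| 1 with h | h
  · have h2 := hω.mul_modVal_le (abs_nonneg (y - x)) h
    calc |f y - f x| * modVal ω 1 ≤ L * |y - x| * modVal ω 1 := by gcongr; exact hlip x y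
      _ = L * (|y - x| * modVal ω 1) := by ring
      _ ≤ L * (1 * modVal ω |y - x|) := by gcongr
      _ ≤ _ := by nlinarith
  · have h2 := hω.modVal_mono h
    have h3 : |f y - f x| ≤ 2 * M := (abs_sub _ _).trans (by linarith [hb x, hb y])
    calc |f y - f x| * modVal ω 1 ≤ 2 * M * modVal ω |y - x| := by gcongr
      _ ≤ _ := by nlinarith

/-- Continuous functions vanishing off a compact interval are bounded, so below the top order the
bounded next derivative gives a Lipschitz bound. -/
theorem IsJet.isBddModulus {m : ℕ} (hω : IsModulus ω) {f : ℕ → ℝ → ℝ} (hf : IsJet m ω f)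
    {a b : ℝ} (h0 : ∀ k, ∀ x ∉ Set.Icc a b, f k x = 0) {k : ℕ} (hk : k ≤ m) :
    IsBddModulus ω (f k) := by
  have hb : ∀ k ≤ m, ∃ M : ℝ, 0 ≤ M ∧ ∀ x, |f k x| ≤ M := by
    intro k hk
    obtain ⟨M, hM⟩ := isCompact_Icc.exists_bound_of_continuousOn (s := Set.Icc a b)
      (hf.continuous hω hk).continuousOn
    refine ⟨max M 0, le_max_right _ _, fun x => ?_⟩
    by_cases hx : x ∈ Set.Icc a b
    · exact (hM x hx).trans (le_max_left _ _)
    · simp [h0 k x hx]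
  refine ⟨?_, hb k hk⟩
  rcases hk.lt_or_eq with hk' | rfl
  · obtain ⟨M, hM, h1⟩ := hb k hk
    obtain ⟨L, hL, h2⟩ := hb (k + 1) hk'
    refine hasModulus_of_lipschitz hω hL hM (fun x y => ?_) h1
    exact convex_univ.norm_image_sub_le_of_norm_hasDerivWithin_le
      (fun z _ => (hf.1 k hk' z).hasDerivWithinAt) (fun z _ => h2 z) (Set.mem_univ x)
      (Set.mem_univ y)
  · exact hf.2

end BoundedModulus

/-! ### From a compact set to a two-sided set, and construction of the curve. -/

section Sufficiency

variable {ω : ℝ≥0∞ → ℝ≥0∞} {K : Set ℝ}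

/-- The Taylor polynomial at x has the right derivative there, and the remainder is O(ω(|y - x|) |y
- x|^(m-k)) = o(|y - x|), since m - k ≥ 1 and ω tends to 0 at 0. -/
theorem IsWhitneyField.hasDerivWithinAt (hω : IsModulus ω) {m : ℕ} {F : ℕ → ℝ → ℝ}
    (hF : IsWhitneyField m ω K F) {k : ℕ} (hk : k < m) {x : ℝ} (hx : x ∈ K) :
    HasDerivWithinAt (F k) (F (k + 1) x) K x := by
  obtain ⟨C, hC, h⟩ := hF
  obtain ⟨n, hn⟩ : ∃ n, m - k = n + 1 := ⟨m - k - 1, by omega⟩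
  set T := taylorPoly (m - k) (fun l => F (k + l)) x with hT
  have hTd : HasDerivAt (fun y => T.eval y) (F (k + 1) x) x := by
    have := T.hasDerivAt x
    rw [hT, hn, derivative_taylorPoly_succ, taylorPoly_eval_self, add_zero] at this
    rwa [hT, hn]
  have hTx : T.eval x = F k x := taylorPoly_eval_self _ _ _
  have hrem : HasDerivWithinAt (fun y => F k y - T.eval y) 0 K x := by
    rw [hasDerivWithinAt_iff_isLittleO, Asymptotics.isLittleO_iff]
    intro ε hε
    have h1 : Filter.Tendsto (fun y => C * modVal ω |y - x|) (nhds x) (nhds 0) := by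
      have h2 : Filter.Tendsto (fun b => |b - x|) (nhds x) (nhds 0) := by
        have : Continuous fun b : ℝ => |b - x| := by fun_prop
        simpa using this.tendsto x
      simpa using (hω.tendsto_modVal.comp h2).const_mul C
    have h3 : ∀ᶠ y in nhdsWithin x K, C * modVal ω |y - x| < ε :=
      nhdsWithin_le_nhds (h1.eventually (gt_mem_nhds hε))
    have h4 : ∀ᶠ y in nhdsWithin x K, y ∈ Metric.ball x 1 :=
      nhdsWithin_le_nhds (Metric.ball_mem_nhds x one_pos)
    filter_upwards [h3, h4, self_mem_nhdsWithin] with y hy1 hy2 hyK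
    rw [Metric.mem_ball, Real.dist_eq] at hy2
    have h5 := h k hk.le x hx y hyK
    simp only [hTx, sub_self, sub_zero, smul_zero, Real.norm_eq_abs]
    refine h5.trans ?_
    rw [hn, pow_succ]
    have h6 : |y - x| ^ n * |y - x| ≤ 1 * |y - x| := by
      gcongr
      exact pow_le_one₀ (abs_nonneg _) hy2.le
    rw [one_mul] at h6
    have h7 := modVal_nonneg ω |y - x|
    gcongr
  have := hrem.add hTd.hasDerivWithinAt
  rw [zero_add] at this
  exact this.congr (fun y _ => by simp) (by simp)

/-- The set `K` together with two rays at distance `1` from it. -/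
def addRays (K : Set ℝ) : Set ℝ := K ∪ (Set.Iic (sInf K - 1) ∪ Set.Ici (sSup K + 1))

theorem isTwoSided_addRays (hK : IsCompact K) : IsTwoSided (addRays K) where
  isClosed := hK.isClosed.union (isClosed_Iic.union isClosed_Ici)
  exists_le x := ⟨min x (sInf K - 1), Or.inr (Or.inl (Set.mem_Iic.2 (min_le_right _ _))), min_le_left _ _⟩
  exists_ge x := ⟨max x (sSup K + 1), Or.inr (Or.inr (Set.mem_Ici.2 (le_max_right _ _))), le_max_left _ _⟩

theorem sInf_le_and_le_sSup (hK : IsCompact K) {x : ℝ} (hx : x ∈ K) :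
    sInf K ≤ x ∧ x ≤ sSup K :=
  ⟨csInf_le hK.bddBelow hx, le_csSup hK.bddAbove hx⟩

/-- Beside the gaps of K itself the rays create exactly two new ones, both of length 1, so their
estimates need no uniformity. -/
theorem IsGap.cases_addRays (hK : IsCompact K) (hne : K.Nonempty) {a b : ℝ}
    (h : IsGap (addRays K) a b) :
    (a ∈ K ∧ b ∈ K) ∨ (a = sInf K - 1 ∧ b = sInf K) ∨ (a = sSup K ∧ b = sSup K + 1) := by
  have hinf := hK.sInf_mem hne
  have hsup := hK.sSup_mem hne
  have hbd := sInf_le_and_le_sSup hK hinf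
  have hab := h.lt
  have hno := h.notMem
  rcases h.left_mem with ha | ha | ha
  · rcases h.right_mem with hb | hb | hb
    · exact Or.inl ⟨ha, hb⟩
    · have := sInf_le_and_le_sSup hK ha
      rw [Set.mem_Iic] at hb
      linarith
    · right; right
      rw [Set.mem_Ici] at hb
      have ha' := sInf_le_and_le_sSup hK ha
      constructor
      · by_contra hne'
        exact hno _ ⟨lt_of_le_of_ne ha'.2 hne', by linarith⟩ (Or.inl hsup)
      · by_contra hne'
        exact hno _ ⟨by linarith, lt_of_le_of_ne hb (Ne.symm hne')⟩
          (Or.inr (Or.inr Set.self_mem_Ici))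
  · rw [Set.mem_Iic] at ha
    have ha' : a = sInf K - 1 := by
      by_contra hne'
      have hlt := lt_of_le_of_ne ha hne'
      obtain ⟨z, hz1, hz2⟩ := exists_between (lt_min hab hlt)
      exact hno z ⟨hz1, hz2.trans_le (min_le_left _ _)⟩
        (Or.inr (Or.inl (hz2.trans_le (min_le_right _ _)).le))
    right; left
    refine ⟨ha', le_antisymm ?_ ?_⟩
    · by_contra! hlt
      exact hno _ ⟨by linarith, hlt⟩ (Or.inl hinf)
    · rcases h.right_mem with hb | hb | hb
      · exact (sInf_le_and_le_sSup hK hb).1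
      · rw [Set.mem_Iic] at hb
        linarith
      · rw [Set.mem_Ici] at hb
        linarith
  · rw [Set.mem_Ici] at ha
    obtain ⟨z, hz1, hz2⟩ := exists_between hab
    exact absurd (Or.inr (Or.inr (ha.trans hz1.le))) (hno z ⟨hz1, hz2⟩)

/-- Near a point of K the enlarged set coincides with K; off K the extension by zero vanishes
locally. -/
theorem hasDerivWithinAt_indicator_addRays (hK : IsCompact K) {v v' : ℝ → ℝ}
    (hv : ∀ x ∈ K, HasDerivWithinAt v (v' x) K x) (x : ℝ) :
    HasDerivWithinAt (K.indicator v) (K.indicator v' x) (addRays K) x := by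
  by_cases hx : x ∈ K
  · rw [Set.indicator_of_mem hx]
    have hbd := sInf_le_and_le_sSup hK hx
    have h1 : K ∈ nhdsWithin x (addRays K) := by
      refine mem_nhdsWithin.2 ⟨Set.Ioo (sInf K - 1) (sSup K + 1), isOpen_Ioo,
        ⟨by linarith, by linarith⟩, ?_⟩
      rintro y ⟨hy, hyK | hyK | hyK⟩
      · exact hyK
      · exact absurd hy.1 (not_lt.2 hyK)
      · exact absurd hy.2 (not_lt.2 hyK)
    exact ((hv x hx).congr (fun y hy => Set.indicator_of_mem hy v)
      (Set.indicator_of_mem hx v)).mono_of_mem_nhdsWithin h1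
  · rw [Set.indicator_of_notMem hx]
    refine ((hasDerivAt_const x (0 : ℝ)).congr_of_eventuallyEq ?_).hasDerivWithinAt
    filter_upwards [hK.isClosed.isOpen_compl.mem_nhds hx] with y hy
    exact Set.indicator_of_notMem hy v

/-- Points of K and of the rays are at distance at least 1, so the differences between them are
absorbed by sup |v| / ω(1). -/
theorem indicator_modulus_addRays (hω : IsModulus ω) (hK : IsCompact K) {v : ℝ → ℝ}
    (hv : ContinuousOn v K) {C : ℝ} (hC : 0 ≤ C)
    (h : ∀ x ∈ K, ∀ y ∈ K, |v y - v x| ≤ C * modVal ω |y - x|) :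
    ∃ C' : ℝ, 0 ≤ C' ∧ ∀ x ∈ addRays K, ∀ y ∈ addRays K,
      |K.indicator v y - K.indicator v x| ≤ C' * modVal ω |y - x| := by
  obtain ⟨M, hM⟩ := hK.exists_bound_of_continuousOn hv
  have h1 := hω.modVal_pos one_pos
  set M' := max M 0 with hM'
  have hM0 : 0 ≤ M' := le_max_right _ _
  have hfar : ∀ x ∈ K, ∀ y ∈ addRays K, y ∉ K → |v x| ≤ M' / modVal ω 1 * modVal ω |y - x| := by
    intro x hx y hy hyK
    have hbd := sInf_le_and_le_sSup hK hx
    have h2 : 1 ≤ |y - x| := by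
      rcases hy with hy | hy | hy
      · exact absurd hy hyK
      · rw [Set.mem_Iic] at hy
        rw [abs_sub_comm]
        exact le_trans (by linarith) (le_abs_self _)
      · rw [Set.mem_Ici] at hy
        exact le_trans (by linarith) (le_abs_self _)
    have h3 := hω.modVal_mono h2
    rw [div_mul_eq_mul_div, le_div_iff₀ h1]
    have h4 : |v x| ≤ M' := (hM x hx).trans (le_max_left _ _)
    gcongr
  refine ⟨C + M' / modVal ω 1, by positivity, fun x hx y hy => ?_⟩
  have hw := modVal_nonneg ω |y - x|
  have hw1 : 0 ≤ C * modVal ω |y - x| := by positivity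
  have hw2 : 0 ≤ M' / modVal ω 1 * modVal ω |y - x| := by positivity
  rw [add_mul]
  by_cases hxK : x ∈ K <;> by_cases hyK : y ∈ K
  · rw [Set.indicator_of_mem hxK, Set.indicator_of_mem hyK]
    linarith [h x hxK y hyK]
  · rw [Set.indicator_of_mem hxK, Set.indicator_of_notMem hyK, zero_sub, abs_neg]
    linarith [hfar x hxK y hy hyK]
  · rw [Set.indicator_of_notMem hxK, Set.indicator_of_mem hyK, sub_zero]
    have := hfar y hyK x hx hxK
    rw [abs_sub_comm x y] at this
    linarith
  · rw [Set.indicator_of_notMem hxK, Set.indicator_of_notMem hyK, sub_zero, abs_zero]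
    linarith

theorem exists_const_forall_le (m : ℕ) (u w : ℕ → ℝ) (hw : ∀ k, 0 < w k) :
    ∃ C : ℝ, 0 ≤ C ∧ ∀ k ≤ m, |u k| ≤ C * w k := by
  refine ⟨∑ k ∈ Finset.range (m + 1), |u k| / w k,
    Finset.sum_nonneg fun k _ => div_nonneg (abs_nonneg _) (hw k).le, fun k hk => ?_⟩
  rw [← div_le_iff₀ (hw k)]
  exact Finset.single_le_sum (f := fun k => |u k| / w k)
    (fun k _ => div_nonneg (abs_nonneg _) (hw k).le) (Finset.mem_range.2 (by omega))

theorem velocity_pos (hω : IsModulus ω) (m : ℕ) (F G : ℕ → ℝ → ℝ) {a b : ℝ} (hab : a < b) :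
    0 < velocity m ω F G a b := by
  have hL : 0 < b - a := sub_pos.2 hab
  have hw := hω.modVal_pos hL
  have : 0 ≤ ∫ x in a..b, (|(taylorPoly m F a).derivative.eval x|
        + |(taylorPoly m G a).derivative.eval x|) :=
    intervalIntegral.integral_nonneg hab.le fun x _ => by positivity
  unfold velocity
  positivity

/-- The estimates on an interval that are needed to fill it, with constant `C`. -/
structure GapEstimate (m : ℕ) (ω : ℝ≥0∞ → ℝ≥0∞) (F G H : ℕ → ℝ → ℝ) (C a b : ℝ) : Prop where
  left : ∀ k ≤ m, |F k b - (taylorPoly (m - k) (fun l => F (k + l)) a).eval b| ≤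
    C * modVal ω (b - a) * (b - a) ^ (m - k)
  right : ∀ k ≤ m, |G k b - (taylorPoly (m - k) (fun l => G (k + l)) a).eval b| ≤
    C * modVal ω (b - a) * (b - a) ^ (m - k)
  area : |areaDiscrepancy m F G H a b| ≤ C * velocity m ω F G a b

theorem GapEstimate.mono (hω : IsModulus ω) {m : ℕ} {F G H : ℕ → ℝ → ℝ} {C C' a b : ℝ}
    (hab : a < b) (h : GapEstimate m ω F G H C a b) (hC : C ≤ C') :
    GapEstimate m ω F G H C' a b := by
  have hL : 0 < b - a := sub_pos.2 hab
  have hw := hω.modVal_pos hL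
  have hv := velocity_pos hω m F G hab
  exact ⟨fun k hk => (h.left k hk).trans (by gcongr), fun k hk => (h.right k hk).trans (by gcongr),
    h.area.trans (by gcongr)⟩

/-- All right-hand sides are positive, so on a single interval some constant always works; this
serves the two gaps next to the rays. -/
theorem exists_gapEstimate (hω : IsModulus ω) (m : ℕ) (F G H : ℕ → ℝ → ℝ) {a b : ℝ}
    (hab : a < b) : ∃ C : ℝ, 0 ≤ C ∧ GapEstimate m ω F G H C a b := by
  have hL : 0 < b - a := sub_pos.2 hab
  have hw := hω.modVal_pos hL
  have hv := velocity_pos hω m F G hab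
  have hpos : ∀ k, 0 < modVal ω (b - a) * (b - a) ^ (m - k) := fun k => by positivity
  obtain ⟨C₁, hC₁, h1⟩ := exists_const_forall_le m
    (fun k => F k b - (taylorPoly (m - k) (fun l => F (k + l)) a).eval b) _ hpos
  obtain ⟨C₂, hC₂, h2⟩ := exists_const_forall_le m
    (fun k => G k b - (taylorPoly (m - k) (fun l => G (k + l)) a).eval b) _ hpos
  set C₃ := |areaDiscrepancy m F G H a b| / velocity m ω F G a b with hC₃
  have hC₃0 : 0 ≤ C₃ := by positivity
  refine ⟨C₁ + C₂ + C₃, by positivity, fun k hk => ?_, fun k hk => ?_, ?_⟩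
  · rw [mul_assoc]
    exact (h1 k hk).trans (mul_le_mul_of_nonneg_right (by linarith) (hpos k).le)
  · rw [mul_assoc]
    exact (h2 k hk).trans (mul_le_mul_of_nonneg_right (by linarith) (hpos k).le)
  · rw [← div_le_iff₀ hv, ← hC₃]
    linarith

theorem IsWhitneyField.modulus_top {m : ℕ} {F : ℕ → ℝ → ℝ} (h : IsWhitneyField m ω K F) :
    ∃ C : ℝ, 0 ≤ C ∧ ∀ x ∈ K, ∀ y ∈ K, |F m y - F m x| ≤ C * modVal ω |y - x| := by
  obtain ⟨C, hC, h⟩ := h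
  refine ⟨C, hC.le, fun x hx y hy => ?_⟩
  have := h m le_rfl x hx y hy
  simpa [taylorPoly_eval] using this

theorem exists_horizontal_extension {m : ℕ} (hm : 1 ≤ m) (hω : IsModulus ω) (hK : IsCompact K)
    (hne : K.Nonempty) {F G H : ℕ → ℝ → ℝ} (hFc : ContinuousOn (F m) K)
    (hGc : ContinuousOn (G m) K) (hF : IsWhitneyField m ω K F) (hG : IsWhitneyField m ω K G)
    (hH : IsWhitneyField m ω K H)
    (hlift : ∀ k, 1 ≤ k → k ≤ m → ∀ x ∈ K, H k x = liftDeriv F G k x) {C : ℝ} (hC : 1 ≤ C)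
    (hA : ∀ a ∈ K, ∀ b ∈ K, a < b →
      |areaDiscrepancy m F G H a b| ≤ C * velocity m ω F G a b) :
    ∃ f g h : ℕ → ℝ → ℝ, IsJet m ω f ∧ IsJet m ω g ∧ IsJet m ω h ∧
      (∀ x, HasDerivAt (h 0) (2 * (f 1 x * g 0 x - g 1 x * f 0 x)) x) ∧
      ∀ k ≤ m, ∀ x ∈ K, f k x = F k x ∧ g k x = G k x ∧ h k x = H k x := by
  have hE := isTwoSided_addRays hK
  set F' : ℕ → ℝ → ℝ := fun k => K.indicator (F k) with hF'
  set G' : ℕ → ℝ → ℝ := fun k => K.indicator (G k) with hG'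
  set H' : ℕ → ℝ → ℝ := fun k => K.indicator (H k) with hH'
  have memF : ∀ x ∈ K, ∀ k, F' k x = F k x := fun x hx k => Set.indicator_of_mem hx _
  have memG : ∀ x ∈ K, ∀ k, G' k x = G k x := fun x hx k => Set.indicator_of_mem hx _
  have memH : ∀ x ∈ K, ∀ k, H' k x = H k x := fun x hx k => Set.indicator_of_mem hx _
  obtain ⟨c₁, hc₁, hF1⟩ := hF.modulus_top
  obtain ⟨c₂, hc₂, hG1⟩ := hG.modulus_top
  obtain ⟨C₁, hC₁, hF2⟩ := indicator_modulus_addRays hω hK hFc hc₁ hF1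
  obtain ⟨C₂, hC₂, hG2⟩ := indicator_modulus_addRays hω hK hGc hc₂ hG1
  obtain ⟨C₃, hC₃, hF3⟩ := hF
  obtain ⟨C₄, hC₄, hG3⟩ := hG
  obtain ⟨C₅, hC₅, he5⟩ := exists_gapEstimate hω m F' G' H' (sub_one_lt (sInf K))
  obtain ⟨C₆, hC₆, he6⟩ := exists_gapEstimate hω m F' G' H' (lt_add_one (sSup K))
  set C₀ := C + C₁ + C₂ + C₃ + C₄ + C₅ + C₆ with hC₀
  have hgap : ∀ a b, IsGap (addRays K) a b → GapEstimate m ω F' G' H' C₀ a b := by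
    intro a b hab
    have hlt := hab.lt
    rcases hab.cases_addRays hK hne with ⟨ha, hb⟩ | ⟨rfl, rfl⟩ | ⟨rfl, rfl⟩
    · have hL : 0 < b - a := sub_pos.2 hlt
      have hw := hω.modVal_pos hL
      have hv := velocity_pos hω m F G hlt
      refine ⟨fun k hk => ?_, fun k hk => ?_, ?_⟩
      · rw [memF b hb, taylorPoly_congr fun l _ => memF a ha (k + l)]
        have := hF3 k hk a ha b hb
        rw [abs_of_pos hL] at this
        refine this.trans ?_
        gcongr
        linarith
      · rw [memG b hb, taylorPoly_congr fun l _ => memG a ha (k + l)]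
        have := hG3 k hk a ha b hb
        rw [abs_of_pos hL] at this
        refine this.trans ?_
        gcongr
        linarith
      · rw [areaDiscrepancy_congr (fun k _ => memF a ha k) (fun k _ => memG a ha k)
          (memH a ha 0) (memF b hb 0) (memG b hb 0) (memH b hb 0),
          velocity_congr (fun k _ => memF a ha k) (fun k _ => memG a ha k)]
        refine (hA a ha b hb hlt).trans ?_
        gcongr
        linarith
    · exact he5.mono hω hlt (by linarith)
    · exact he6.mono hω hlt (by linarith)
  have hdF : ∀ k < m, ∀ x ∈ addRays K, HasDerivWithinAt (F' k) (F' (k + 1) x) (addRays K) x :=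
    fun k hk x _ => hasDerivWithinAt_indicator_addRays hK
      (fun x hx => IsWhitneyField.hasDerivWithinAt hω ⟨C₃, hC₃, hF3⟩ hk hx) x
  have hdG : ∀ k < m, ∀ x ∈ addRays K, HasDerivWithinAt (G' k) (G' (k + 1) x) (addRays K) x :=
    fun k hk x _ => hasDerivWithinAt_indicator_addRays hK
      (fun x hx => IsWhitneyField.hasDerivWithinAt hω ⟨C₄, hC₄, hG3⟩ hk hx) x
  -- Condition 2 with k = 1 identifies H¹ with the contact expression on K; off K both sides are
  -- zero.
  have hdH : ∀ x ∈ addRays K, HasDerivWithinAt (H' 0)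
      (2 * (F' 1 x * G' 0 x - G' 1 x * F' 0 x)) (addRays K) x := by
    intro x _
    have h1 := hasDerivWithinAt_indicator_addRays hK
      (fun x hx => hH.hasDerivWithinAt hω (k := 0) (by omega) hx) x
    refine h1.congr_deriv ?_
    by_cases hx : x ∈ K
    · rw [memF x hx, memF x hx, memG x hx, memG x hx, Set.indicator_of_mem hx,
        hlift _ le_rfl hm x hx, liftDeriv_one]
    · simp [hF', hG', Set.indicator_of_notMem hx]
  obtain ⟨f, g, h, hjf, hjg, hh, hfE, hgE, hhE⟩ := exists_extension hm hω hE (C₀ := C₀)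
    (by linarith) hdF hdG hdH
    (fun x hx y hy => (hF2 x hx y hy).trans
      (mul_le_mul_of_nonneg_right (by linarith) (modVal_nonneg _ _)))
    (fun x hx y hy => (hG2 x hx y hy).trans
      (mul_le_mul_of_nonneg_right (by linarith) (modVal_nonneg _ _)))
    (fun a b hab => (hgap a b hab).left) (fun a b hab => (hgap a b hab).right)
    (fun a b hab => (hgap a b hab).area)
  -- The jets of f and g vanish on the rays, so all their derivatives up to order m are bounded on
  -- the line.
  have hout : ∀ x ∉ Set.Icc (sInf K - 1) (sSup K + 1), x ∈ addRays K ∧ x ∉ K := by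
    intro x hx
    constructor
    · rw [Set.mem_Icc, not_and_or, not_le, not_le] at hx
      exact Or.inr (hx.imp (fun h => Set.mem_Iic.2 h.le) (fun h => Set.mem_Ici.2 h.le))
    · intro hxK
      have := sInf_le_and_le_sSup hK hxK
      exact hx ⟨by linarith, by linarith⟩
  have hbf : ∀ k ≤ m, IsBddModulus ω (f k) := fun k hk => hjf.isBddModulus hω
    (fun k x hx => (hfE k x (hout x hx).1).trans (Set.indicator_of_notMem (hout x hx).2 _)) hk
  have hbg : ∀ k ≤ m, IsBddModulus ω (g k) := fun k hk => hjg.isBddModulus hω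
    (fun k x hx => (hgE k x (hout x hx).1).trans (Set.indicator_of_notMem (hout x hx).2 _)) hk
  have hKE : ∀ x ∈ K, x ∈ addRays K := fun x hx => Or.inl hx
  have hfK : ∀ x ∈ K, ∀ k, f k x = F k x := fun x hx k => (hfE k x (hKE x hx)).trans (memF x hx k)
  have hgK : ∀ x ∈ K, ∀ k, g k x = G k x := fun x hx k => (hgE k x (hKE x hx)).trans (memG x hx k)
  -- Order 0 is separate because `liftDeriv f g 0` is an empty sum. The higher derivatives of h are
  -- given by the Leibniz formula, and condition 2 matches them with H on K.
  refine ⟨f, g, fun k => if k = 0 then h else liftDeriv f g k, hjf, hjg, ⟨?_, ?_⟩, ?_, ?_⟩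
  · intro k hk x
    rcases Nat.eq_zero_or_pos k with rfl | hk0
    · simpa [liftDeriv_one] using hh x
    · simpa [hk0.ne'] using hasDerivAt_liftDeriv hjf.1 hjg.1 hk0 hk x
  · simp only [if_neg (by omega : ¬ m = 0)]
    exact (isBddModulus_liftDeriv hbf hbg).1
  · simpa using hh
  · intro k hk x hx
    refine ⟨hfK x hx k, hgK x hx k, ?_⟩
    rcases Nat.eq_zero_or_pos k with rfl | hk0
    · simpa using (hhE x (hKE x hx)).trans (memH x hx 0)
    · simp only [if_neg hk0.ne']
      rw [hlift k hk0 hk x hx,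
        liftDeriv_congr (fun l _ => hfK x hx l) (fun l _ => hgK x hx l) hk]

end Sufficiency

end HeisWhitney

/-! ### The equivalence. -/

theorem theorem1p1 (m : ℕ) (hm : 1 ≤ m) (ω : ENNReal → ENNReal) (hω : HeisWhitney.IsModulus ω)
    (K : Set ℝ) (hK : IsCompact K) (F G H : ℕ → ℝ → ℝ)
    (hF : ∀ k ≤ m, ContinuousOn (F k) K)
    (hG : ∀ k ≤ m, ContinuousOn (G k) K)
    (hH : ∀ k ≤ m, ContinuousOn (H k) K) :
    (∃ Γ : ℝ → EuclideanSpace ℝ (Fin 3),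
        HeisWhitney.IsHorizontalCurve Γ ∧ HeisWhitney.IsCmOmega m ω Γ ∧
        ∀ k ≤ m, ∀ x ∈ K, iteratedDeriv k Γ x = !₂[F k x, G k x, H k x]) ↔
      ((HeisWhitney.IsWhitneyField m ω K F ∧ HeisWhitney.IsWhitneyField m ω K G ∧
          HeisWhitney.IsWhitneyField m ω K H) ∧
        (∀ k, 1 ≤ k → k ≤ m → ∀ x ∈ K,
          H k x = 2 * ∑ i ∈ Finset.range k,
            ((k - 1).choose i : ℝ) * (F (k - i) x * G i x - G (k - i) x * F i x)) ∧
        ∃ C : ℝ, 1 ≤ C ∧ ∀ a ∈ K, ∀ b ∈ K, a < b →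
          |HeisWhitney.areaDiscrepancy m F G H a b| ≤ C * HeisWhitney.velocity m ω F G a b) := by
  open HeisWhitney in
  constructor
  · rintro ⟨Γ, hhor, hΓ, hjet⟩
    exact conditions_of_horizontal hm hω hhor hΓ hjet
  · rintro ⟨⟨hWF, hWG, hWH⟩, hlift, C, hC, hA⟩
    obtain ⟨f, g, h, hjf, hjg, hjh, hder, hK'⟩ : ∃ f g h : ℕ → ℝ → ℝ,
        IsJet m ω f ∧ IsJet m ω g ∧ IsJet m ω h ∧
        (∀ x, HasDerivAt (h 0) (2 * (f 1 x * g 0 x - g 1 x * f 0 x)) x) ∧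
        ∀ k ≤ m, ∀ x ∈ K, f k x = F k x ∧ g k x = G k x ∧ h k x = H k x := by
      -- For empty K the zero curve works; the description of the gaps next to the rays needs inf K
      -- and sup K to lie in K.
      rcases K.eq_empty_or_nonempty with rfl | hne
      · have h0 : IsJet m ω (fun _ _ => 0) :=
          ⟨fun _ _ x => hasDerivAt_const x 0, (isBddModulus_const ω 0).1⟩
        exact ⟨_, _, _, h0, h0, h0, fun x => by simpa using hasDerivAt_const x (0 : ℝ),
          fun _ _ x hx => absurd hx (Set.notMem_empty x)⟩
      · exact exists_horizontal_extension hm hω hK hne (hF m le_rfl) (hG m le_rfl) hWF hWG hWH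
          hlift hC hA
    refine ⟨_, isHorizontalCurve_vec3 (hjf.1 0 hm) (hjg.1 0 hm) hder (hjf.continuous hω hm)
      (hjg.continuous hω hm), isCmOmega_vec3 hω hjf hjg hjh, fun k hk x hx => ?_⟩
    obtain ⟨h1, h2, h3⟩ := hK' k hk x hx
    rw [iteratedDeriv_vec3 hjf.1 hjg.1 hjh.1 k hk, ← h1, ← h2, ← h3]
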